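/- All graphs are finite, simple and undirected. A graph is $k$-connected if it has more than $k$ vertices and no set of fewer than $k$ vertices whose deletion disconnects it. A nontrivial $k$-cut of a graph $G$ is a set $T$ of $k$ vertices such that $G-T$ is disconnected and the components of $G-T$ can be partitioned into two subgraphs $G_1$ and $G_2$ with $|V(G_1)|\ge 2$ and $|V(G_2)|\ge 2$. A graph is quasi $5$-connected if it is $4$-connected and has no nontrivial $4$-cut. An edge $e$ of a quasi $5$-connected graph $G$ is quasi $5$-contractible if the graph $G/e$, obtained by identifying the ends of $e$ and suppressing the resulting loop and multiple edges, is again quasi $5$-connected. Theorem. Let $G$ be a quasi $5$-connected graph. If $d_G(x)+d_G(y)\ge 9$ for every pair $x,y$ of vertices of $G$ at distance one or two, then $G$ contains a quasi $5$-contractible edge. -/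

import Mathlib

namespace QuasiConn

/-- A graph is `k`-connected if it has more than `k` vertices and cannot be disconnected by
deleting fewer than `k` vertices. In particular the complete graph on `n + 1` vertices is
`n`-connected but not `(n + 1)`-connected. -/
def IsKConnected {V : Type*} (G : SimpleGraph V) (k : ℕ) : Prop :=
  k < Nat.card V ∧ ∀ S : Set V, S.ncard < k → (G.induce Sᶜ).Connected

/-- `T` is a cut of `G`: the graph `G - T` is disconnected. -/
def IsCut {V : Type*} (G : SimpleGraph V) (T : Set V) : Prop :=
  ¬ (G.induce Tᶜ).Preconnected

/-- `T` is a nontrivial `k`-cut of `G`: a cut with `k` elements such that the set of components of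
`G - T` can be split into two parts (`C` and its complement), each of which covers at least two
vertices. -/
def IsNontrivialCut {V : Type*} (G : SimpleGraph V) (k : ℕ) (T : Set V) : Prop :=
  T.ncard = k ∧ IsCut G T ∧
    ∃ C : Set (G.induce Tᶜ).ConnectedComponent,
      2 ≤ {v : ↥Tᶜ | (G.induce Tᶜ).connectedComponentMk v ∈ C}.ncard ∧
      2 ≤ {v : ↥Tᶜ | (G.induce Tᶜ).connectedComponentMk v ∉ C}.ncard

/-- A graph is quasi `k`-connected (`k ≥ 1`) if it is `(k - 1)`-connected and has no nontrivial
`(k - 1)`-cut. -/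
def IsQuasiConnected {V : Type*} (G : SimpleGraph V) (k : ℕ) : Prop :=
  IsKConnected G (k - 1) ∧ ∀ T : Set V, ¬ IsNontrivialCut G (k - 1) T

/-- The equivalence relation on the vertices that identifies the two ends of `e` and nothing
else. -/
def contractSetoid {V : Type*} (e : Sym2 V) : Setoid V where
  r a b := a = b ∨ (a ∈ e ∧ b ∈ e)
  iseqv :=
    { refl := fun _ => Or.inl rfl
      symm := by
        rintro a b (h | ⟨h₁, h₂⟩)
        · exact Or.inl h.symm
        · exact Or.inr ⟨h₂, h₁⟩
      trans := by
        rintro a b c (rfl | ⟨h₁, h₂⟩) (rfl | ⟨h₃, h₄⟩)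
        · exact Or.inl rfl
        · exact Or.inr ⟨h₃, h₄⟩
        · exact Or.inr ⟨h₁, h₂⟩
        · exact Or.inr ⟨h₁, h₄⟩ }

/-- The contraction `G / e`: the ends of `e` are identified, and loops and multiple edges are
suppressed. (`SimpleGraph.map` makes two distinct classes adjacent exactly if some members of them
are adjacent in `G`.) -/
def contract {V : Type*} (G : SimpleGraph V) (e : Sym2 V) :
    SimpleGraph (Quotient (contractSetoid e)) :=
  G.map (Quotient.mk (contractSetoid e))

/-- `e` is a quasi `k`-contractible edge of `G`. -/
def IsQuasiContractible {V : Type*} (G : SimpleGraph V) (k : ℕ) (e : Sym2 V) : Prop :=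
  e ∈ G.edgeSet ∧ IsQuasiConnected (contract G e) k

end QuasiConn

/-! Contracting `xy` can destroy quasi 5-connectivity only through a separation of `G` whose middle
contains both `x` and `y`: either the middle is the neighbourhood of a vertex of degree four, or it
has five vertices and both sides have at least two (`IsQuasiConnected.edge_cases`). The degree
condition keeps vertices of degree four at pairwise distance at least three. If no edge is
contractible, these facts make `G` a `Critical` graph, which is refuted in two stages.

Stage one excludes vertices `z` of degree four. Every edge at `z` lies in the middle of a nontrivial
separation of order five. As `z` has only four neighbours, some side contains exactly one of them,
and crossing with a separation through that neighbour shrinks this side to two vertices. Two such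
pairs lie in each other's boundary (`LinkedPairs`). An edge joining them must be covered by a
further separation, and every position of the other pair vertices relative to it is contradictory
(`LinkedPairs.false_of_critical`).

Stage two: minimum degree five makes `G` 5-connected, with every edge in the middle of a nontrivial
separation of order five, which `not_edgesCovered` refutes. A double count shows that a smallest
side has two vertices. The two vertices of such a pair `{p, q}` have nested neighbourhoods in its
boundary (`IsNSep.not_private`), so every boundary vertex lies with both of them in some middle. A
smallest side of a separation through `p`, `q` and a boundary vertex is again a pair, inside the
boundary of the first. A separation through this new pair and the vertex of `p`, `q` with the
smaller neighbourhood separates `p` from `q` in a way that nestedness forbids. -/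

set_option linter.unusedSectionVars false

namespace QuasiConn

/-! ### Separations and uncrossing. -/

variable {V : Type*} [Fintype V] [DecidableEq V] {G : SimpleGraph V} [DecidableRel G.Adj]

/-- `(A, S, B)` is a separation: a partition of the vertices into three sets without edges
between `A` and `B`. -/
structure IsSep (G : SimpleGraph V) (A S B : Finset V) : Prop where
  cover : ∀ v, v ∈ A ∨ v ∈ S ∨ v ∈ B
  left_mid : ∀ v, v ∈ A → v ∉ S
  left_right : ∀ v, v ∈ A → v ∉ B
  mid_right : ∀ v, v ∈ S → v ∉ B
  not_adj : ∀ a ∈ A, ∀ b ∈ B, ¬ G.Adj a b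

/-- A separation of order five both of whose sides have at least two vertices. -/
structure IsNSep (G : SimpleGraph V) (A S B : Finset V) : Prop extends IsSep G A S B where
  card_mid : S.card = 5
  two_le_left : 2 ≤ A.card
  two_le_right : 2 ≤ B.card

/-- Every separation with nonempty sides has order at least five. -/
def FiveConn (G : SimpleGraph V) : Prop :=
  ∀ A S B : Finset V, IsSep G A S B → A.Nonempty → B.Nonempty → 5 ≤ S.card

/-- Every separation whose sides have at least two vertices has order at least five. -/
def QuasiFive (G : SimpleGraph V) : Prop :=
  ∀ A S B : Finset V, IsSep G A S B → 2 ≤ A.card → 2 ≤ B.card → 5 ≤ S.card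

lemma FiveConn.quasi (hconn : FiveConn G) : QuasiFive G :=
  fun _ _ _ hs h1 h2 => hconn _ _ _ hs (Finset.card_pos.1 (by omega)) (Finset.card_pos.1 (by omega))

/-- The boundary of the corner `A ∩ C` of two crossing separations with middles `S` and `R`. -/
def cornerMid (A S C R : Finset V) : Finset V := (A ∩ R) ∪ (S ∩ R) ∪ (S ∩ C)

lemma mem_cornerMid {A S C R : Finset V} {v : V} :
    v ∈ cornerMid A S C R ↔ (v ∈ A ∧ v ∈ R) ∨ (v ∈ S ∧ v ∈ R) ∨ (v ∈ S ∧ v ∈ C) := by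
  simp [cornerMid]

namespace IsSep

variable {A S B C R D : Finset V}

lemma symm (h : IsSep G A S B) : IsSep G B S A where
  cover v := by have := h.cover v; tauto
  left_mid v hv hs := h.mid_right v hs hv
  left_right v hv hs := h.left_right v hs hv
  mid_right v hv hs := h.left_mid v hs hv
  not_adj a ha b hb hab := h.not_adj b hb a ha hab.symm

lemma card_inter (h : IsSep G A S B) (X : Finset V) :
    (X ∩ A).card + (X ∩ S).card + (X ∩ B).card = X.card := by
  rw [← Finset.card_union_of_disjoint, ← Finset.card_union_of_disjoint]
  · congr 1
    ext v
    have := h.cover v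
    simp only [Finset.mem_union, Finset.mem_inter]
    tauto
  · rw [Finset.disjoint_left]
    intro v hv hv'
    simp only [Finset.mem_union, Finset.mem_inter] at hv hv'
    rcases hv with hv | hv
    · exact h.left_right v hv.2 hv'.2
    · exact h.mid_right v hv.2 hv'.2
  · rw [Finset.disjoint_left]
    intro v hv hv'
    simp only [Finset.mem_inter] at hv hv'
    exact h.left_mid v hv.2 hv'.2

lemma card_inter' (h : IsSep G A S B) (X : Finset V) :
    (A ∩ X).card + (S ∩ X).card + (B ∩ X).card = X.card := by
  have := h.card_inter X
  rwa [Finset.inter_comm X, Finset.inter_comm X, Finset.inter_comm X] at this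

/-- Uncrossing. The middles of the opposite corners `A ∩ C` and `B ∩ D` have `|S| + |R|` vertices in
total, so a large middle at one corner forces a small one at the other. -/
lemma corner (h : IsSep G A S B) (k : IsSep G C R D) :
    IsSep G (A ∩ C) (cornerMid A S C R) (B ∪ D) where
  cover v := by
    have := h.cover v; have := k.cover v
    simp only [Finset.mem_union, Finset.mem_inter, mem_cornerMid]; tauto
  left_mid v := by
    have := h.left_mid v; have := k.left_mid v
    simp only [Finset.mem_inter, mem_cornerMid]; tauto
  left_right v := by
    have := h.left_right v; have := k.left_right v
    simp only [Finset.mem_inter, Finset.mem_union]; tauto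
  mid_right v := by
    have := h.left_right v; have := k.left_right v
    have := h.mid_right v; have := k.mid_right v
    simp only [Finset.mem_union, mem_cornerMid]; tauto
  not_adj a ha b hb := by
    simp only [Finset.mem_union, Finset.mem_inter] at ha hb
    rcases hb with hb | hb
    · exact h.not_adj a ha.1 b hb
    · exact k.not_adj a ha.2 b hb

lemma card_corner (h : IsSep G A S B) (k : IsSep G C R D) :
    (cornerMid A S C R).card = (A ∩ R).card + (S ∩ R).card + (S ∩ C).card := by
  rw [cornerMid, Finset.card_union_of_disjoint, Finset.card_union_of_disjoint]
  · rw [Finset.disjoint_left]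
    intro v hv hv'
    simp only [Finset.mem_inter] at hv hv'
    exact h.left_mid v hv.1 hv'.1
  · rw [Finset.disjoint_left]
    intro v hv hv'
    simp only [Finset.mem_union, Finset.mem_inter] at hv hv'
    exact k.left_mid v hv'.2 (by tauto)

/-- Moving a middle vertex without neighbours on the left to the right. -/
lemma move_right (h : IsSep G A S B) {s : V} (hs : s ∈ S) (hn : ∀ a ∈ A, ¬ G.Adj s a) :
    IsSep G A (S.erase s) (insert s B) where
  cover v := by
    have := h.cover v
    by_cases hv : v = s <;> simp_all
  left_mid v hv := by
    have := h.left_mid v hv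
    simp [this]
  left_right v hv := by
    have := h.left_right v hv
    have := h.left_mid v hv
    simp only [Finset.mem_insert, not_or]
    exact ⟨by rintro rfl; exact this hs, by assumption⟩
  mid_right v hv := by
    simp only [Finset.mem_erase] at hv
    have := h.mid_right v hv.2
    simp [this, hv.1]
  not_adj a ha b hb := by
    simp only [Finset.mem_insert] at hb
    rcases hb with rfl | hb
    · exact fun h' => hn a ha h'.symm
    · exact h.not_adj a ha b hb

/-- Moving a left vertex into the middle. -/
lemma move_mid (h : IsSep G A S B) {a : V} (ha : a ∈ A) :
    IsSep G (A.erase a) (insert a S) B where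
  cover v := by
    have := h.cover v
    by_cases hv : v = a <;> simp_all
  left_mid v hv := by
    simp only [Finset.mem_erase] at hv
    have := h.left_mid v hv.2
    simp [this, hv.1]
  left_right v hv := h.left_right v (Finset.mem_of_mem_erase hv)
  mid_right v hv := by
    simp only [Finset.mem_insert] at hv
    rcases hv with rfl | hv
    · exact h.left_right _ ha
    · exact h.mid_right v hv
  not_adj b hb := h.not_adj b (Finset.mem_of_mem_erase hb)

/-- If `a` is the only left neighbour of the middle vertex `s`, then `s` can be replaced by `a`. -/
lemma swap (h : IsSep G A S B) {s a : V} (hs : s ∈ S) (ha : a ∈ A)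
    (hn : ∀ b ∈ A, G.Adj s b → b = a) :
    IsSep G (A.erase a) (insert a (S.erase s)) (insert s B) := by
  have h1 := (h.move_mid ha).move_right (s := s) (by simp [hs]) (by
    intro b hb hsb
    simp only [Finset.mem_erase] at hb
    exact hb.1 (hn b hb.2 hsb))
  rwa [Finset.erase_insert_of_ne (by rintro rfl; exact h.left_mid _ ha hs)] at h1

lemma neighbor_mem (h : IsSep G A S B) {a v : V} (ha : a ∈ A) (hv : G.Adj a v) :
    v ∈ A ∨ v ∈ S := by
  rcases h.cover v with h1 | h1 | h1
  · exact Or.inl h1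
  · exact Or.inr h1
  · exact absurd hv (h.not_adj a ha v h1)

end IsSep

namespace IsNSep

variable {A S B C R D : Finset V}

lemma symm (h : IsNSep G A S B) : IsNSep G B S A where
  toIsSep := h.toIsSep.symm
  card_mid := h.card_mid
  two_le_left := h.two_le_right
  two_le_right := h.two_le_left

/-- Otherwise `s` could be moved to the other side, leaving a middle of four vertices between two
sides of at least two. -/
lemma exists_adj_left (hq : QuasiFive G) (h : IsNSep G A S B) {s : V} (hs : s ∈ S) : ∃ a ∈ A, G.Adj s a := by
  by_contra! hn
  have h1 := hq _ _ _ (h.move_right hs hn) h.two_le_left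
    (h.two_le_right.trans (Finset.card_le_card (Finset.subset_insert _ _)))
  rw [Finset.card_erase_of_mem hs, h.card_mid] at h1
  omega

lemma exists_adj_right (hq : QuasiFive G) (h : IsNSep G A S B) {s : V} (hs : s ∈ S) : ∃ a ∈ B, G.Adj s a :=
  h.symm.exists_adj_left hq hs

/-- The nine cells of two crossing separations. -/
lemma cells (h : IsNSep G A S B) (k : IsNSep G C R D) :
    ((A ∩ C).card + (A ∩ R).card + (A ∩ D).card = A.card ∧
    (S ∩ C).card + (S ∩ R).card + (S ∩ D).card = 5 ∧
    (B ∩ C).card + (B ∩ R).card + (B ∩ D).card = B.card) ∧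
    ((A ∩ C).card + (S ∩ C).card + (B ∩ C).card = C.card ∧
    (A ∩ R).card + (S ∩ R).card + (B ∩ R).card = 5 ∧
    (A ∩ D).card + (S ∩ D).card + (B ∩ D).card = D.card) :=
  ⟨⟨k.card_inter A, by rw [k.card_inter S, h.card_mid], k.card_inter B⟩,
    h.card_inter' C, by rw [h.card_inter' R, k.card_mid], h.card_inter' D⟩

end IsNSep

/-! ### A smallest side has two vertices. -/

/-- Uncrossing reduces the crossing of a smallest side `F` with another separation to linear
inequalities on the nine cells. Both corners in `F` turn out to have at most one vertex, and only
these distributions survive. -/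
lemma IsNSep.cross_of_min {F T B C R D : Finset V}
    (hconn : FiveConn G)
    (h : IsNSep G F T B) (k : IsNSep G C R D)
    (hmin : ∀ A S B : Finset V, IsNSep G A S B → F.card ≤ A.card)
    (ha : 1 ≤ (F ∩ R).card) (hb : 1 ≤ (T ∩ R).card) (h3 : 3 ≤ F.card) :
    (F.card = 4 ∧ (F ∩ R).card = 2 ∧ (T ∩ R).card = 1 ∧ (T ∩ C).card = 2 ∧ (T ∩ D).card = 2 ∧
      (F ∩ C).card = 1 ∧ (F ∩ D).card = 1) ∨
    (F.card = 3 ∧ (F ∩ R).card = 1 ∧ (T ∩ R).card = 3 ∧ (T ∩ C).card = 1 ∧ (T ∩ D).card = 1 ∧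
      (F ∩ C).card = 1 ∧ (F ∩ D).card = 1) ∨
    (F.card = 3 ∧ (F ∩ R).card = 2 ∧ (T ∩ R).card = 1 ∧ (T ∩ C).card = 2 ∧ (T ∩ D).card = 2 ∧
      ((F ∩ C).card = 1 ∧ (F ∩ D).card = 0 ∨ (F ∩ C).card = 0 ∧ (F ∩ D).card = 1)) := by
  obtain ⟨⟨e1, e2, e3⟩, e4, e5, e6⟩ := h.cells k
  have corner : ∀ {A S B C R D : Finset V}, IsNSep G A S B → IsNSep G C R D →
      1 ≤ (A ∩ C).card → 5 ≤ (A ∩ R).card + (S ∩ R).card + (S ∩ C).card ∧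
        (2 ≤ (A ∩ C).card → (A ∩ R).card + (S ∩ R).card + (S ∩ C).card = 5 →
          F.card ≤ (A ∩ C).card) := by
    intro A S B C R D h k h1
    rw [← h.toIsSep.card_corner k.toIsSep]
    have hs := h.toIsSep.corner k.toIsSep
    have hB : 2 ≤ (B ∪ D).card := h.two_le_right.trans (Finset.card_le_card Finset.subset_union_left)
    refine ⟨hconn _ _ _ hs (Finset.card_pos.1 h1) (Finset.card_pos.1 (by omega)), fun h2 h5 => ?_⟩
    exact hmin _ _ _ ⟨hs, h5, h2, hB⟩
  have c1 := corner h k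
  have c2 := corner h k.symm
  have c3 := corner h.symm k
  have c4 := corner h.symm k.symm
  have m1 := hmin _ _ _ h.symm
  have m2 := hmin _ _ _ k
  have m3 := hmin _ _ _ k.symm
  clear corner hconn hmin h k
  generalize (F ∩ C).card = f1 at *
  generalize (F ∩ R).card = a at *
  generalize (F ∩ D).card = f2 at *
  generalize (T ∩ C).card = c at *
  generalize (T ∩ R).card = b at *
  generalize (T ∩ D).card = d at *
  generalize (B ∩ C).card = g1 at *
  generalize (B ∩ R).card = e at *
  generalize (B ∩ D).card = g2 at *
  generalize F.card = m at *
  generalize B.card = mb at *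
  generalize C.card = mc at *
  generalize D.card = md at *
  -- A corner in `F` with two vertices and a middle of order five would be a nontrivial side smaller
  -- than `F`, because `F ∩ R` is nonempty.
  have hf1 : 2 ≤ f1 → 6 ≤ a + b + c := fun h2 => by
    obtain ⟨h5, h6⟩ := c1 (by omega)
    by_contra hlt
    have := h6 h2 (by omega)
    omega
  have hf2 : 2 ≤ f2 → 6 ≤ a + b + d := fun h2 => by
    obtain ⟨h5, h6⟩ := c2 (by omega)
    by_contra hlt
    have := h6 h2 (by omega)
    omega
  replace c1 := fun h => (c1 h).1
  replace c2 := fun h => (c2 h).1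
  replace c3 := fun h => (c3 h).1
  replace c4 := fun h => (c4 h).1
  have hf1' : f1 ≤ 1 := by
    by_contra hh
    have h6 := hf1 (by omega)
    -- The middles of opposite corners total ten vertices, so the opposite middle has at most four
    -- and its corner is empty.
    have : g2 = 0 := by
      by_contra hg
      have := c4 (by omega)
      omega
    by_cases hg : g1 = 0
    · omega
    · have := c3 (by omega)
      clear c1 c3 c4 hf1
      by_cases h2 : f2 = 0
      · omega
      · have := c2 (by omega)
        omega
  have hf2' : f2 ≤ 1 := by
    by_contra hh
    have h6 := hf2 (by omega)
    have : g1 = 0 := by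
      by_contra hg
      have := c3 (by omega)
      omega
    by_cases hg : g2 = 0
    · omega
    · have := c4 (by omega)
      clear c2 c3 c4 hf2
      by_cases h2 : f1 = 0
      · omega
      · have := c1 (by omega)
        omega
  clear hf1 hf2
  have d3 : g1 = 0 ∨ 5 ≤ e + b + c := by omega
  have d4 : g2 = 0 ∨ 5 ≤ e + b + d := by omega
  have d1 : f1 = 0 ∨ f1 = 1 ∧ 5 ≤ a + b + c := by omega
  have d2 : f2 = 0 ∨ f2 = 1 ∧ 5 ≤ a + b + d := by omega
  clear c1 c2 c3 c4
  rcases d1 with rfl | ⟨rfl, d1⟩ <;> rcases d2 with rfl | ⟨rfl, d2⟩ <;>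
    rcases d3 with rfl | d3 <;> rcases d4 with rfl | d4 <;> omega

/-- All neighbours of the single corner vertex lie in a middle of five vertices, and degree at least
five leaves no choice. -/
lemma IsSep.neighborFinset_eq_cornerMid
    (hdeg : ∀ v, 5 ≤ (G.neighborFinset v).card) {F T B C R D : Finset V}
    (h : IsSep G F T B) (k : IsSep G C R D) {w : V} (hw : F ∩ C = {w})
    (hc : (F ∩ R).card + (T ∩ R).card + (T ∩ C).card = 5) :
    G.neighborFinset w = cornerMid F T C R := by
  apply Finset.eq_of_subset_of_card_le
  · intro v hv
    rw [SimpleGraph.mem_neighborFinset] at hv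
    rcases (h.corner k).neighbor_mem (hw ▸ Finset.mem_singleton_self w) hv with h1 | h1
    · rw [hw, Finset.mem_singleton] at h1
      subst h1; exact absurd hv (G.loopless.irrefl _)
    · exact h1
  · rw [h.card_corner k, hc]; exact hdeg w

lemma IsSep.card_neighborFinset_inter_mid
    {F T B C R D : Finset V}
    (h : IsSep G F T B) (k : IsSep G C R D) {w : V}
    (hw : G.neighborFinset w = cornerMid F T C R) :
    (G.neighborFinset w ∩ T).card = (T ∩ R).card + (T ∩ C).card := by
  rw [hw, ← Finset.card_union_of_disjoint]
  · congr 1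
    ext v
    have := h.left_mid v
    simp only [Finset.mem_inter, Finset.mem_union, mem_cornerMid]
    tauto
  · rw [Finset.disjoint_left]
    intro v hv hv'
    simp only [Finset.mem_inter] at hv hv'
    exact k.left_mid v hv'.2 hv.2

/-- The consequences of crossing a minimal nontrivial separation with one that
contains an edge `xu` between `T` and `F`. -/
lemma IsNSep.edge_of_min {F T B C R D : Finset V}
    (hconn : FiveConn G)
    (hdeg : ∀ v, 5 ≤ (G.neighborFinset v).card)
    (h : IsNSep G F T B) (k : IsNSep G C R D)
    (hmin : ∀ A S B : Finset V, IsNSep G A S B → F.card ≤ A.card) (h3 : 3 ≤ F.card)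
    {x u : V} (hx : x ∈ T) (hu : u ∈ F) (hxR : x ∈ R) (huR : u ∈ R) :
    (F.card = 4 ∧ ∃ w ∈ F, ∃ w' ∈ F, w ≠ w' ∧ w ≠ u ∧ w' ≠ u ∧ G.Adj x w ∧ G.Adj x w' ∧
      (G.neighborFinset w ∩ T).card = 3 ∧ (G.neighborFinset w' ∩ T).card = 3) ∨
    (F.card = 3 ∧ ∃ w ∈ F, ∃ w' ∈ F, w ≠ w' ∧ w ≠ u ∧ w' ≠ u ∧ ¬ G.Adj w w' ∧ G.Adj w u ∧
      G.Adj w' u ∧ G.Adj x w ∧ G.Adj x w' ∧ ∃ y ∈ T, G.Adj w y ∧ ¬ G.Adj w' y) ∨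
    (F.card = 3 ∧ ∃ w ∈ F, w ≠ u ∧ G.Adj x w ∧ (G.neighborFinset w ∩ T).card = 3 ∧
      ∀ v ∈ F, v ≠ w → G.Adj w v) := by
  have single : ∀ {C R D : Finset V}, IsNSep G C R D → x ∈ R → u ∈ R → (F ∩ C).card = 1 →
      (F ∩ R).card + (T ∩ R).card + (T ∩ C).card = 5 →
      ∃ w ∈ F, w ∈ C ∧ w ≠ u ∧ G.neighborFinset w = cornerMid F T C R ∧ G.Adj x w ∧ G.Adj w u ∧
        (G.neighborFinset w ∩ T).card = (T ∩ R).card + (T ∩ C).card := by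
    intro C R D k hxR huR h1 h5
    obtain ⟨w, hw⟩ := Finset.card_eq_one.1 h1
    have hN := h.toIsSep.neighborFinset_eq_cornerMid hdeg k.toIsSep hw h5
    have hwm : w ∈ F ∩ C := hw ▸ Finset.mem_singleton_self w
    rw [Finset.mem_inter] at hwm
    have hN' : ∀ v, G.Adj w v ↔ v ∈ cornerMid F T C R := by
      intro v; rw [← hN, SimpleGraph.mem_neighborFinset]
    refine ⟨w, hwm.1, hwm.2, ?_, hN, ((hN' x).2 ?_).symm, (hN' u).2 ?_,
      h.toIsSep.card_neighborFinset_inter_mid k.toIsSep hN⟩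
    · rintro rfl; exact k.left_mid _ hwm.2 huR
    · rw [mem_cornerMid]; tauto
    · rw [mem_cornerMid]; tauto
  rcases h.cross_of_min hconn k hmin (Finset.card_pos.2 ⟨u, by simp [hu, huR]⟩)
    (Finset.card_pos.2 ⟨x, by simp [hx, hxR]⟩) h3 with
    ⟨m, a, b, c, d, f1, f2⟩ | ⟨m, a, b, c, d, f1, f2⟩ | ⟨m, a, b, c, d, hf⟩
  · obtain ⟨w, wF, wC, wu, wN, xw, -, wc⟩ := single k hxR huR f1 (by omega)
    obtain ⟨w', wF', wC', wu', wN', xw', -, wc'⟩ := single k.symm hxR huR f2 (by omega)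
    refine Or.inl ⟨m, w, wF, w', wF', ?_, wu, wu', xw, xw', by omega, by omega⟩
    rintro rfl; exact k.left_right _ wC wC'
  · obtain ⟨w, wF, wC, wu, wN, xw, wuA, wc⟩ := single k hxR huR f1 (by omega)
    obtain ⟨w', wF', wC', wu', wN', xw', wuA', wc'⟩ := single k.symm hxR huR f2 (by omega)
    obtain ⟨y, hy⟩ := Finset.card_pos.1 (by omega : 0 < (T ∩ C).card)
    rw [Finset.mem_inter] at hy
    refine Or.inr (Or.inl ⟨m, w, wF, w', wF', ?_, wu, wu', k.not_adj _ wC _ wC', wuA, wuA',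
      xw, xw', y,
      hy.1, ?_, fun hh => k.not_adj y hy.2 w' wC' hh.symm⟩)
    · rintro rfl; exact k.left_right _ wC wC'
    · rw [← SimpleGraph.mem_neighborFinset, wN, mem_cornerMid]; tauto
  · have key : ∀ {C R D : Finset V}, IsNSep G C R D → x ∈ R → u ∈ R → (F ∩ C).card = 1 →
        (F ∩ D).card = 0 → (F ∩ R).card = 2 → (T ∩ R).card = 1 → (T ∩ C).card = 2 →
        ∃ w ∈ F, w ≠ u ∧ G.Adj x w ∧ (G.neighborFinset w ∩ T).card = 3 ∧
          ∀ v ∈ F, v ≠ w → G.Adj w v := by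
      intro C R D k hxR huR f1 f2 a b c
      obtain ⟨w, wF, wC, wu, wN, xw, wuA, wc⟩ := single k hxR huR f1 (by omega)
      refine ⟨w, wF, wu, xw, by omega, ?_⟩
      intro v hv hvw
      rw [← SimpleGraph.mem_neighborFinset, wN, mem_cornerMid]
      refine Or.inl ⟨hv, ?_⟩
      rcases k.cover v with h1 | h1 | h1
      · have := Finset.card_le_one.1 f1.le v (by simp [hv, h1]) w (by simp [wF, wC])
        exact absurd this hvw
      · exact h1
      · rw [Finset.card_eq_zero] at f2
        have : v ∈ F ∩ D := by simp [hv, h1]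
        rw [f2] at this
        exact absurd this (Finset.notMem_empty v)
    refine Or.inr (Or.inr ⟨m, ?_⟩)
    rcases hf with ⟨f1, f2⟩ | ⟨f1, f2⟩
    · exact key k hxR huR f1 f2 a b c
    · exact key k.symm hxR huR f2 f1 a b d

lemma eq_or_eq_or_eq_of_card_three {F : Finset V} (hF : F.card = 3) {u w w' : V} (hu : u ∈ F)
    (hw : w ∈ F) (hw' : w' ∈ F) (h1 : w ≠ w') (h2 : w ≠ u) (h3 : w' ≠ u) {v : V} (hv : v ∈ F) :
    v = u ∨ v = w ∨ v = w' := by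
  have : ({u, w, w'} : Finset V) = F := by
    apply Finset.eq_of_subset_of_card_le
    · intro a; simp only [Finset.mem_insert, Finset.mem_singleton]; rintro (rfl | rfl | rfl) <;> assumption
    · rw [hF, Finset.card_eq_three.2 ⟨u, w, w', h2.symm, h3.symm, h1, rfl⟩]
  rw [← this] at hv
  simpa using hv

/-- In a 5-connected graph all of whose edges lie in nontrivial separations, a smallest side of a
nontrivial separation has two vertices. -/
lemma IsNSep.card_eq_two_of_min {F T B : Finset V}
    (hconn : FiveConn G)
    (hdeg : ∀ v, 5 ≤ (G.neighborFinset v).card)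
    (hedge : ∀ x y, G.Adj x y → ∃ A S B : Finset V, IsNSep G A S B ∧ x ∈ S ∧ y ∈ S)
    (h : IsNSep G F T B)
    (hmin : ∀ A S B : Finset V, IsNSep G A S B → F.card ≤ A.card) : F.card = 2 := by
  by_contra hF
  have h3 : 3 ≤ F.card := by have := h.two_le_left; omega
  have edge := fun (x u : V) (hx : x ∈ T) (hu : u ∈ F) (hxu : G.Adj x u) =>
    let ⟨C, R, D, k, hxR, huR⟩ := hedge x u hxu
    h.edge_of_min hconn hdeg k hmin h3 hx hu hxR huR
  set small := F.filter (fun w => (G.neighborFinset w ∩ T).card = 3) with hsmall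
  -- Applying the crossing analysis again to the edge from `x` to the vertex just found yields
  -- further vertices of `small`.
  have many : ∀ x ∈ T, F.card ≤ (small.filter (fun w => G.Adj x w)).card + 1 := by
    intro x hx
    obtain ⟨u, hu, hxu⟩ := h.exists_adj_left hconn.quasi hx
    by_cases h4 : F.card = 4
    · rcases edge x u hx hu hxu with ⟨-, w, wF, w', wF', -, -, -, xw, -, wc, -⟩ |
        ⟨hh, -⟩ | ⟨hh, -⟩
      · rcases edge x w hx wF xw with ⟨-, v, vF, v', vF', vv, vw, vw', xv, xv', vc, vc'⟩ |
          ⟨hh, -⟩ | ⟨hh, -⟩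
        · have : ({w, v, v'} : Finset V) ⊆ small.filter (fun w => G.Adj x w) := by
            intro a; simp only [Finset.mem_insert, Finset.mem_singleton]
            rintro (rfl | rfl | rfl) <;> simp [*]
          have := Finset.card_le_card this
          rw [Finset.card_eq_three.2 ⟨w, v, v', vw.symm, vw'.symm, vv, rfl⟩] at this
          omega
        all_goals omega
      all_goals omega
    · have sm : ∀ u ∈ F, G.Adj x u → ∃ w ∈ F, w ≠ u ∧ G.Adj x w ∧
          (G.neighborFinset w ∩ T).card = 3 := by
        intro u hu hxu
        rcases edge x u hx hu hxu with ⟨hh, -⟩ | ⟨m, w, wF, w', wF', ww, wu, wu', wwn, wua, wua', -, -, y,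
          hy, wy, wy'⟩ | ⟨-, w, wF, wu, xw, wc, -⟩
        · omega
        · have hyu : G.Adj y u := by
            rcases edge y w hy wF wy.symm with ⟨hh, -⟩ | ⟨-, v, vF, v', vF', vv, vw, vw', vvn, -⟩ |
              ⟨-, v, vF, vw, yv, -, -⟩
            · omega
            · exfalso
              rcases eq_or_eq_or_eq_of_card_three m hu wF wF' ww wu wu' vF with rfl | rfl | rfl <;>
                rcases eq_or_eq_or_eq_of_card_three m hu wF wF' ww wu wu' vF' with rfl | rfl | rfl <;>
                simp_all [G.adj_comm]
            · rcases eq_or_eq_or_eq_of_card_three m hu wF wF' ww wu wu' vF with rfl | rfl | rfl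
              · exact yv
              · exact absurd rfl vw
              · exact absurd yv.symm wy'
          exfalso
          rcases edge y u hy hu hyu with ⟨hh, -⟩ | ⟨-, v, vF, v', vF', vv, vw, vw', vvn, -, -, yv, yv', -⟩ |
              ⟨-, v, vF, vw, yv, -, hv⟩
          · omega
          · rcases eq_or_eq_or_eq_of_card_three m hu wF wF' ww wu wu' vF with rfl | rfl | rfl <;>
              rcases eq_or_eq_or_eq_of_card_three m hu wF wF' ww wu wu' vF' with rfl | rfl | rfl <;>
              simp_all [G.adj_comm]
          · rcases eq_or_eq_or_eq_of_card_three m hu wF wF' ww wu wu' vF with rfl | rfl | rfl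
            · exact vw rfl
            · exact wwn (hv _ wF' ww.symm)
            · exact wy' yv.symm
        · exact ⟨w, wF, wu, xw, wc⟩
      obtain ⟨w, wF, wu, xw, wc⟩ := sm u hu hxu
      obtain ⟨v, vF, vw, xv, vc⟩ := sm w wF xw
      have : ({w, v} : Finset V) ⊆ small.filter (fun w => G.Adj x w) := by
        intro a; simp only [Finset.mem_insert, Finset.mem_singleton]
        rintro (rfl | rfl) <;> simp [*]
      have := Finset.card_le_card this
      rw [Finset.card_pair vw.symm] at this
      rcases edge x u hx hu hxu with ⟨hh, -⟩ | ⟨hh, -⟩ | ⟨hh, -⟩ <;> omega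
  -- Counting edges between `T` and `small` both ways gives `5 (|F| - 1) ≤ 3 |F|`, which fails for
  -- `|F| ≥ 3`.
  have e1 := Finset.sum_card_bipartiteAbove_eq_sum_card_bipartiteBelow (s := T) (t := small)
    (fun x w => G.Adj x w)
  have e2 : ∑ x ∈ T, (small.filter (fun w => G.Adj x w)).card =
      ∑ w ∈ small, (T.filter (fun x => G.Adj x w)).card := e1
  have e3 : ∑ w ∈ small, (T.filter (fun x => G.Adj x w)).card = small.card * 3 := by
    rw [Finset.sum_const_nat]
    intro w hw
    rw [hsmall, Finset.mem_filter] at hw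
    rw [← hw.2]
    congr 1
    ext v
    simp [G.adj_comm, and_comm]
  have e4 : T.card * (F.card - 1) ≤ ∑ x ∈ T, (small.filter (fun w => G.Adj x w)).card := by
    rw [← smul_eq_mul]
    apply Finset.card_nsmul_le_sum
    intro x hx; have := many x hx; omega
  rw [h.card_mid] at e4
  have e5 : small.card ≤ F.card := Finset.card_filter_le _ _
  omega

/-! ### Pairs: sides with two vertices. -/

lemma IsSep.pair_neighbor {p q v : V} {T B : Finset V} (h : IsSep G {p, q} T B)
    (hv : G.Adj p v) : v = q ∨ v ∈ T := by
  rcases h.neighbor_mem (by simp) hv with h1 | h1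
  · simp only [Finset.mem_insert, Finset.mem_singleton] at h1
    rcases h1 with rfl | h1
    · exact absurd hv (G.loopless.irrefl _)
    · exact Or.inl h1
  · exact Or.inr h1

lemma IsNSep.pair_swap {p q : V} {T B : Finset V} (h : IsNSep G {p, q} T B) :
    IsNSep G {q, p} T B := by rwa [Finset.pair_comm]

lemma IsNSep.pair_ne {p q : V} {T B : Finset V} (h : IsNSep G {p, q} T B) : p ≠ q := by
  rintro rfl
  have := h.two_le_left
  simp at this

lemma IsNSep.pair_notMem {p q : V} {T B : Finset V} (h : IsNSep G {p, q} T B) : p ∉ T :=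
  h.left_mid p (by simp)

/-- A pair vertex of degree at least five missing a vertex of the boundary is adjacent to everything
else. -/
lemma IsNSep.pair_adj {p q y : V} {T B : Finset V}
    (hdeg : 5 ≤ (G.neighborFinset p).card) (h : IsNSep G {p, q} T B) (hy : y ∈ T)
    (hpy : ¬ G.Adj p y) : G.Adj p q ∧ ∀ v ∈ T, v ≠ y → G.Adj p v := by
  have hsub : G.neighborFinset p ⊆ insert q (T.erase y) := by
    intro v hv
    rw [SimpleGraph.mem_neighborFinset] at hv
    rcases h.toIsSep.pair_neighbor hv with rfl | h1
    · simp
    · simp only [Finset.mem_insert, Finset.mem_erase]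
      exact Or.inr ⟨by rintro rfl; exact hpy hv, h1⟩
  have heq := Finset.eq_of_subset_of_card_le hsub (by
    refine (Finset.card_insert_le _ _).trans ?_
    rw [Finset.card_erase_of_mem hy, h.card_mid]; exact hdeg)
  refine ⟨?_, fun v hv hvy => ?_⟩ <;> rw [← SimpleGraph.mem_neighborFinset, heq] <;> simp [*]

lemma IsNSep.exists_adj_of_conn {A S B : Finset V} (hconn : FiveConn G) (h : IsNSep G A S B) {s : V} (hs : s ∈ S) :
    (∃ a ∈ A, G.Adj s a) ∧ ∃ b ∈ B, G.Adj s b := by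
  exact ⟨h.exists_adj_left hconn.quasi hs, h.exists_adj_right hconn.quasi hs⟩

lemma IsNSep.card_corner_of_conn {A S B C R D : Finset V} (hconn : FiveConn G) (h : IsNSep G A S B)
    (k : IsNSep G C R D) (hne : 1 ≤ (A ∩ C).card) :
    5 ≤ (A ∩ R).card + (S ∩ R).card + (S ∩ C).card := by
  rw [← h.toIsSep.card_corner k.toIsSep]
  refine hconn _ _ _ (h.toIsSep.corner k.toIsSep) (Finset.card_pos.1 hne) ?_
  have hB : B.Nonempty := Finset.card_pos.1 (by have := h.two_le_right; omega)
  exact hB.mono Finset.subset_union_left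

/-- If a pair lies in the middle of a separation whose middle meets the boundary of the pair, then
the boundary is split into parts of size `2`, `1`, `2`. -/
lemma IsNSep.pair_subset {p q : V} (hconn : FiveConn G) {T B C R D : Finset V} (h : IsNSep G {p, q} T B)
    (k : IsNSep G C R D) (hp : p ∈ R) (hq : q ∈ R) (hT : (T ∩ R).Nonempty) :
    (T ∩ R).card = 1 ∧ (T ∩ C).card = 2 ∧ (T ∩ D).card = 2 := by
  obtain ⟨⟨e1, e2, e3⟩, e4, e5, e6⟩ := h.cells k
  have hF : ({p, q} : Finset V) ∩ R = {p, q} := by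
    rw [Finset.inter_eq_left]; intro v; simp; rintro (rfl | rfl) <;> assumption
  have hF2 : ({p, q} : Finset V).card = 2 := Finset.card_pair h.pair_ne
  rw [hF] at e1 e5
  have nb : ∀ {C R D : Finset V}, IsNSep G C R D → p ∈ R → q ∈ R → 1 ≤ (T ∩ C).card := by
    intro C R D k hp hq
    obtain ⟨a, ha, hpa⟩ := (k.exists_adj_of_conn hconn hp).1
    rcases h.toIsSep.pair_neighbor hpa with rfl | h1
    · exact absurd hq (k.left_mid _ ha)
    · exact Finset.card_pos.2 ⟨a, by simp [h1, ha]⟩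
  have n1 := nb k hp hq
  have n2 := nb k.symm hp hq
  have c1 := h.symm.card_corner_of_conn hconn k
  have c2 := h.symm.card_corner_of_conn hconn k.symm
  have := Finset.card_pos.2 hT
  have := k.two_le_left
  have := k.two_le_right
  -- Since `p` and `q` use two places in `R`, `|B ∩ R| + |T ∩ R| = 3`. If `|T ∩ C| = 1`, the corner
  -- `B ∩ C` would have a middle of order four, hence be empty, leaving `C` with one vertex.
  have d1 : (B ∩ C).card = 0 ∨ 5 ≤ (B ∩ R).card + (T ∩ R).card + (T ∩ C).card := by omega
  have d2 : (B ∩ D).card = 0 ∨ 5 ≤ (B ∩ R).card + (T ∩ R).card + (T ∩ D).card := by omega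
  clear c1 c2
  omega

/-- The neighbour of `p` in `D` lies in `T` and is missed by `q`. As `q` misses at most one vertex
of `T`, it is the only vertex of `T ∩ D`. -/
lemma IsNSep.pair_split {p q : V} (hconn : FiveConn G) {T B C R D : Finset V}
    (hdeg : ∀ v, 5 ≤ (G.neighborFinset v).card) (h : IsNSep G {p, q} T B)
    (k : IsNSep G C R D) (hp : p ∈ R) (hq : q ∈ C) :
    ∃ y ∈ T, T ∩ D = {y} ∧ G.Adj p y ∧ ¬ G.Adj q y := by
  obtain ⟨y, hy, hpy⟩ := (k.exists_adj_of_conn hconn hp).2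
  have hyT : y ∈ T := by
    rcases h.toIsSep.pair_neighbor hpy with rfl | h1
    · exact absurd hy (k.left_right _ hq)
    · exact h1
  have hyq : ∀ v ∈ D, ¬ G.Adj q v := fun v hv => k.not_adj q hq v hv
  refine ⟨y, hyT, ?_, hpy, hyq y hy⟩
  obtain ⟨-, hall⟩ := h.pair_swap.pair_adj (hdeg _) hyT (hyq y hy)
  ext v
  simp only [Finset.mem_inter, Finset.mem_singleton]
  constructor
  · rintro ⟨hv, hvD⟩
    by_contra hne
    exact hyq v hvD (hall v hv hne)
  · rintro rfl; exact ⟨hyT, hy⟩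

/-- If `q` were on a side, `pair_split` would give it a second missed vertex of `T`, different from
`y` because it is outside `R`. -/
lemma IsNSep.pair_special {p q y : V} (hconn : FiveConn G) {T B C R D : Finset V}
    (hdeg : ∀ v, 5 ≤ (G.neighborFinset v).card) (h : IsNSep G {p, q} T B)
    (k : IsNSep G C R D) (hp : p ∈ R) (hyT : y ∈ T) (hy : y ∈ R) (hqy : ¬ G.Adj q y) :
    q ∈ R := by
  have key : ∀ {C R D : Finset V}, IsNSep G C R D → p ∈ R → y ∈ R → q ∉ C := by
    intro C R D k hp hy hq
    obtain ⟨y', hy', hTD, -, hqy'⟩ := h.pair_split hconn hdeg k hp hq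
    have : y' ∈ T ∩ D := by rw [hTD]; simp
    rw [Finset.mem_inter] at this
    have hne : y ≠ y' := by rintro rfl; exact k.mid_right _ hy this.2
    exact hqy ((h.pair_swap.pair_adj (hdeg _) hy' hqy').2 y hyT hne)
  rcases k.cover q with h1 | h1 | h1
  · exact absurd h1 (key k hp hy)
  · exact h1
  · exact absurd h1 (key k.symm hp hy)

/-- The neighbours of `p` and `q` lie in `T ∪ {p, q}`. So, once `A ∩ T` joins the middle, both can
leave it for the right side, and the new middle has `|S| - 2 + |A ∩ T|` vertices. -/
lemma IsSep.card_of_sdiff_nonempty {p q : V} (hconn : FiveConn G) {T B A S B' : Finset V} (h : IsNSep G {p, q} T B)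
    (k : IsSep G A S B') (hp : p ∈ S) (hq : q ∈ S) (hne : (A \ T).Nonempty) :
    7 ≤ S.card + (A ∩ T).card := by
  have hpq := h.pair_ne
  have hsep : IsSep G (A \ T) (((S.erase p).erase q) ∪ (A ∩ T)) (insert p (insert q B')) := by
    refine ⟨fun v => ?_, fun v hv => ?_, fun v hv => ?_, fun v hv => ?_, fun a ha b hb => ?_⟩
    · have := k.cover v
      simp only [Finset.mem_sdiff, Finset.mem_union, Finset.mem_erase, Finset.mem_inter,
        Finset.mem_insert]
      tauto
    · have := k.left_mid v
      simp only [Finset.mem_sdiff, Finset.mem_union, Finset.mem_erase, Finset.mem_inter] at *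
      tauto
    · have := k.left_mid v
      have := k.left_right v
      simp only [Finset.mem_sdiff, Finset.mem_insert] at *
      rintro (rfl | rfl | h1) <;> tauto
    · have h1 := k.left_mid v
      have := k.left_right v
      have := k.mid_right v
      simp only [Finset.mem_union, Finset.mem_erase, Finset.mem_inter, Finset.mem_insert] at *
      rintro (rfl | rfl | h1) <;> tauto
    · simp only [Finset.mem_sdiff, Finset.mem_insert] at ha hb
      rcases hb with rfl | rfl | hb
      · intro hab
        rcases h.toIsSep.pair_neighbor hab.symm with rfl | h1
        · exact k.left_mid _ ha.1 hq
        · exact ha.2 h1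
      · intro hab
        rcases h.pair_swap.toIsSep.pair_neighbor hab.symm with rfl | h1
        · exact k.left_mid _ ha.1 hp
        · exact ha.2 h1
      · exact k.not_adj a ha.1 b hb
  have h5 := hconn _ _ _ hsep hne ⟨p, by simp⟩
  have h6 := Finset.card_union_le ((S.erase p).erase q) (A ∩ T)
  rw [Finset.card_erase_of_mem (by simp [hq, hpq.symm]), Finset.card_erase_of_mem hp] at h6
  have : 2 ≤ S.card := by
    rw [← Finset.card_pair hpq]
    apply Finset.card_le_card
    intro v; simp; rintro (rfl | rfl) <;> assumption
  omega

/-- Two separations through a pair, one through each of two private neighbours, force a side with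
two vertices. -/
lemma IsNSep.card_eq_two_of_cross {p q y y' : V} (hconn : FiveConn G) {T B C R D C' R' D' : Finset V}
    (h : IsNSep G {p, q} T B) (k : IsNSep G C R D) (k' : IsNSep G C' R' D')
    (hp : p ∈ R) (hq : q ∈ R) (hy : y ∈ R) (hp' : p ∈ R') (hq' : q ∈ R') (hy' : y' ∈ R')
    (hyT : y ∈ T) (hyT' : y' ∈ T) (hyC : y ∈ C') (hyC' : y' ∈ C) : C.card = 2 ∨ C'.card = 2 := by
  obtain ⟨⟨e1, e2, e3⟩, e4, e5, e6⟩ := k.cells k'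
  obtain ⟨b1, b2, b3⟩ := h.pair_subset hconn k hp hq ⟨y, by simp [*]⟩
  obtain ⟨b1', b2', b3'⟩ := h.pair_subset hconn k' hp' hq' ⟨y', by simp [*]⟩
  have r2 : 2 ≤ (R ∩ R').card := by
    rw [← Finset.card_pair h.pair_ne]
    apply Finset.card_le_card
    intro v; simp only [Finset.mem_insert, Finset.mem_singleton, Finset.mem_inter]
    rintro (rfl | rfl) <;> simp [*]
  have n1 : 1 ≤ (C ∩ R').card := Finset.card_pos.2 ⟨y', by simp [*]⟩
  have n2 : 1 ≤ (R ∩ C').card := Finset.card_pos.2 ⟨y, by simp [*]⟩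
  have TR : T ∩ R = {y} := by
    obtain ⟨a, ha⟩ := Finset.card_eq_one.1 b1
    have : y ∈ T ∩ R := Finset.mem_inter.2 ⟨hyT, hy⟩
    rw [ha, Finset.mem_singleton] at this
    rw [ha, this]
  have TR' : T ∩ R' = {y'} := by
    obtain ⟨a, ha⟩ := Finset.card_eq_one.1 b1'
    have : y' ∈ T ∩ R' := Finset.mem_inter.2 ⟨hyT', hy'⟩
    rw [ha, Finset.mem_singleton] at this
    rw [ha, this]
  have t1 := k'.toIsSep.card_inter (T ∩ C)
  have t2 := k'.toIsSep.card_inter (T ∩ D)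
  have t3 := k.toIsSep.card_inter (T ∩ C')
  have t4 := k.toIsSep.card_inter (T ∩ D')
  have z1 : (T ∩ C ∩ R').card = 1 := by
    rw [Finset.inter_right_comm, TR', Finset.singleton_inter_of_mem hyC', Finset.card_singleton]
  have z2 : (T ∩ D ∩ R').card = 0 := by
    rw [Finset.inter_right_comm, TR', Finset.singleton_inter_of_notMem (k.left_right _ hyC')]
    rfl
  have z3 : (T ∩ C' ∩ R).card = 1 := by
    rw [Finset.inter_right_comm, TR, Finset.singleton_inter_of_mem hyC, Finset.card_singleton]
  have z4 : (T ∩ D' ∩ R).card = 0 := by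
    rw [Finset.inter_right_comm, TR, Finset.singleton_inter_of_notMem (k'.left_right _ hyC)]
    rfl
  have corner : ∀ {C R D C' R' D' : Finset V}, IsNSep G C R D → IsNSep G C' R' D' → p ∈ R →
      q ∈ R → p ∈ R' → q ∈ R' → (T ∩ C ∩ C').card ≤ (C ∩ C').card ∧
      ((C ∩ C').card = 0 ∨ 5 ≤ (C ∩ R').card + (R ∩ R').card + (R ∩ C').card) ∧
      ((C ∩ C').card = (T ∩ C ∩ C').card ∨
        7 ≤ (C ∩ R').card + (R ∩ R').card + (R ∩ C').card + (T ∩ C ∩ C').card) := by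
    intro C R D C' R' D' k k' hp hq hp' hq'
    have heq : C ∩ C' ∩ T = T ∩ C ∩ C' := by
      rw [Finset.inter_comm, Finset.inter_assoc]
    refine ⟨?_, ?_, ?_⟩
    · rw [← heq]; exact Finset.card_le_card Finset.inter_subset_left
    · have := k.card_corner_of_conn hconn k'
      omega
    · rw [← heq, ← k.toIsSep.card_corner k'.toIsSep]
      rcases Finset.eq_empty_or_nonempty ((C ∩ C') \ T) with h0 | h0
      · left
        rw [Finset.sdiff_eq_empty_iff_subset] at h0
        rw [Finset.inter_eq_left.2 h0]
      · right
        exact IsSep.card_of_sdiff_nonempty hconn h (k.toIsSep.corner k'.toIsSep)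
          (by simp [mem_cornerMid, *]) (by simp [mem_cornerMid, *]) h0
  obtain ⟨l1, m1, o1⟩ := corner k k' hp hq hp' hq'
  obtain ⟨l2, m2, o2⟩ := corner k k'.symm hp hq hp' hq'
  obtain ⟨l3, m3, o3⟩ := corner k.symm k' hp hq hp' hq'
  obtain ⟨l4, m4, o4⟩ := corner k.symm k'.symm hp hq hp' hq'
  rw [Finset.inter_right_comm T C' C, Finset.inter_right_comm T C' D] at t3
  rw [Finset.inter_right_comm T D' C, Finset.inter_right_comm T D' D] at t4
  clear corner hconn h k k'
  generalize (T ∩ C ∩ C').card = τ11 at *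
  generalize (T ∩ C ∩ D').card = τ13 at *
  generalize (T ∩ D ∩ C').card = τ31 at *
  generalize (T ∩ D ∩ D').card = τ33 at *
  generalize (C ∩ C').card = n11 at *
  generalize (C ∩ D').card = n13 at *
  generalize (D ∩ C').card = n31 at *
  generalize (D ∩ D').card = n33 at *
  generalize (C ∩ R').card = n12 at *
  generalize (R ∩ C').card = n21 at *
  generalize (R ∩ R').card = n22 at *
  generalize (R ∩ D').card = n23 at *
  generalize (D ∩ R').card = n32 at *
  -- Apart from `y` and `y'`, the boundary `T` has one vertex in `C`, two in `D`, one in `C'` and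
  -- two in `D'`; so `τ11` determines the four corner counts.
  have : τ11 = 0 ∨ τ11 = 1 := by omega
  rcases this with h0 | h0
  · have h13 : τ13 = 1 := by omega
    have h31 : τ31 = 1 := by omega
    have h33 : τ33 = 1 := by omega
    subst h0 h13 h31 h33
    have f2 : 5 ≤ n12 + n22 + n23 := by omega
    have f3 : 5 ≤ n32 + n22 + n21 := by omega
    have f4 : 5 ≤ n32 + n22 + n23 := by omega
    have g2 : n13 = 1 := by omega
    have g1 : n11 = 0 := by omega
    left; omega
  · have h13 : τ13 = 0 := by omega
    have h31 : τ31 = 0 := by omega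
    have h33 : τ33 = 2 := by omega
    subst h0 h13 h31 h33
    have f1 : 5 ≤ n12 + n22 + n21 := by omega
    have f4 : 5 ≤ n32 + n22 + n23 := by omega
    have g1 : n11 = 1 := by omega
    have g2 : n13 = 0 := by omega
    have g3 : n31 = 0 := by omega
    omega

/-- Every edge lies in the middle of a nontrivial separation of order five. -/
def EdgesCovered (G : SimpleGraph V) : Prop :=
  ∀ x y, G.Adj x y → ∃ A S B : Finset V, IsNSep G A S B ∧ x ∈ S ∧ y ∈ S

/-! ### Two pairs in each other's boundary, and nested neighbourhoods. -/

lemma eq_singleton_of_card_one {X : Finset V} (h : X.card = 1) {v : V} (hv : v ∈ X) : X = {v} := by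
  obtain ⟨a, ha⟩ := Finset.card_eq_one.1 h
  rw [ha, Finset.mem_singleton] at hv
  rw [ha, hv]

/-- Covering `q y₁` by a separation determines the neighbourhoods of `y` and of one more vertex `t`:
the side away from `y₂` must be exactly `{y, t}`. -/
lemma IsNSep.crossing_pairs {p q y₁ y₂ y : V} {T B S D : Finset V} (hconn : FiveConn G)
    (hdeg : ∀ v, 5 ≤ (G.neighborFinset v).card) (hedge : EdgesCovered G)
    (h : IsNSep G {p, q} T B) (k : IsNSep G {y₁, y₂} S D) (hpS : p ∈ S) (hqS : q ∈ S)
    (hy₁ : y₁ ∈ T) (hy₂ : y₂ ∈ T) (hyT : y ∈ T) (hyS : y ∈ S)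
    (hqy : ¬ G.Adj q y) (hpy₁ : ¬ G.Adj p y₁) (hy₁y : G.Adj y₁ y) (hy₂y : ¬ G.Adj y₂ y) :
    ∃ R : Finset V, ∃ t, R.card = 5 ∧ p ∈ R ∧ q ∈ R ∧ y₁ ∈ R ∧ t ∈ T ∧ t ≠ y ∧ t ≠ y₁ ∧ t ≠ y₂ ∧
      G.neighborFinset t = insert y (R.erase y₁) ∧ G.neighborFinset y = insert t (R.erase q) := by
  have hy1y : y₁ ≠ y := hy₁y.ne
  have hqy₁ : G.Adj q y₁ := (h.pair_swap.pair_adj (hdeg _) hyT hqy).2 _ hy₁ hy1y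
  have hy₂all := k.pair_swap.pair_adj (hdeg _) hyS hy₂y
  have TS : T ∩ S = {y} := eq_singleton_of_card_one
    (h.pair_subset hconn k hpS hqS ⟨y, Finset.mem_inter.2 ⟨hyT, hyS⟩⟩).1
    (Finset.mem_inter.2 ⟨hyT, hyS⟩)
  have hTS : ∀ v ∈ T, v ∈ S → v = y := fun v h1 h2 => by
    have : v ∈ T ∩ S := Finset.mem_inter.2 ⟨h1, h2⟩
    rwa [TS, Finset.mem_singleton] at this
  have key : ∀ {C R D' : Finset V}, IsNSep G C R D' → p ∈ R → q ∈ R → y₁ ∈ R → y₂ ∈ C →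
      ∃ t, t ∈ T ∧ t ≠ y ∧ t ≠ y₁ ∧ t ≠ y₂ ∧
      G.neighborFinset t = insert y (R.erase y₁) ∧ G.neighborFinset y = insert t (R.erase q) := by
    intro C R E r hp hq h1 h2
    obtain ⟨v, hvS, hSE, hv1, hv2⟩ := k.pair_split hconn hdeg r h1 h2
    have hvy : v = y := by
      by_contra hne
      exact hv2 (hy₂all.2 v hvS hne)
    subst hvy
    have hvE : v ∈ E := by
      have : v ∈ S ∩ E := by rw [hSE]; simp
      exact (Finset.mem_inter.1 this).2
    obtain ⟨c1, c2, c3⟩ := h.pair_subset hconn r hp hq ⟨y₁, Finset.mem_inter.2 ⟨hy₁, h1⟩⟩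
    have hnb : ∀ b ∈ E, G.Adj y₁ b → b = v := by
      intro b hb hyb
      rcases k.toIsSep.pair_neighbor hyb with rfl | hbS
      · exact absurd hb (r.left_right _ h2)
      · have : b ∈ S ∩ E := Finset.mem_inter.2 ⟨hbS, hb⟩
        rwa [hSE, Finset.mem_singleton] at this
    -- Otherwise `y₁` could be exchanged for its only neighbour in `E`. Both separations would then
    -- have to split `T` as `2`, `1`, `2`, yet `y₁` joins the two vertices of `T` already in `C`.
    have hE : E.card = 2 := by
      by_contra hE
      have hs := r.symm.toIsSep.swap h1 hvE hnb
      have hn : IsNSep G (E.erase v) (insert v (R.erase y₁)) (insert y₁ C) := by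
        refine ⟨hs, ?_, ?_, ?_⟩
        · rw [Finset.card_insert_of_notMem, Finset.card_erase_of_mem h1, r.card_mid]
          exact fun hh => r.mid_right _ (Finset.mem_of_mem_erase hh) hvE
        · rw [Finset.card_erase_of_mem hvE]
          have := r.two_le_right
          omega
        · exact r.two_le_left.trans (Finset.card_le_card (Finset.subset_insert _ _))
      have hpn : p ≠ y₁ := by rintro rfl; exact h.pair_notMem hy₁
      have hqn : q ≠ y₁ := by rintro rfl; exact h.pair_swap.pair_notMem hy₁
      obtain ⟨-, -, d3⟩ := h.pair_subset hconn hn (by simp [*]) (by simp [*])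
        ⟨v, Finset.mem_inter.2 ⟨hyT, by simp⟩⟩
      rw [Finset.inter_insert_of_mem hy₁, Finset.card_insert_of_notMem, c2] at d3
      · omega
      · exact fun hh => r.left_mid _ (Finset.mem_inter.1 hh).2 h1
    have hET : E ⊆ T := by
      have : T ∩ E = E := Finset.eq_of_subset_of_card_le Finset.inter_subset_right (by omega)
      rw [← this]; exact Finset.inter_subset_left
    obtain ⟨t, ht⟩ := Finset.card_eq_one.1 (by rw [Finset.card_erase_of_mem hvE, hE] :
      (E.erase v).card = 1)
    have htE : t ∈ E.erase v := by rw [ht]; simp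
    rw [Finset.mem_erase] at htE
    have hEeq : ∀ b ∈ E, b = v ∨ b = t := by
      intro b hb
      by_cases hbv : b = v
      · exact Or.inl hbv
      · right
        have : b ∈ E.erase v := Finset.mem_erase.2 ⟨hbv, hb⟩
        rwa [ht, Finset.mem_singleton] at this
    refine ⟨t, hET htE.2, htE.1, ?_, ?_, ?_, ?_⟩
    · rintro rfl; exact r.mid_right _ h1 htE.2
    · rintro rfl; exact r.left_right _ h2 htE.2
    · apply Finset.eq_of_subset_of_card_le
      · intro b hb
        rw [SimpleGraph.mem_neighborFinset] at hb
        rcases r.symm.toIsSep.neighbor_mem htE.2 hb with h3 | h3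
        · rcases hEeq b h3 with rfl | rfl
          · simp
          · exact absurd hb (G.loopless.irrefl _)
        · simp only [Finset.mem_insert, Finset.mem_erase]
          refine Or.inr ⟨?_, h3⟩
          rintro rfl
          exact htE.1 (hnb t htE.2 hb.symm)
      · rw [Finset.card_insert_of_notMem, Finset.card_erase_of_mem h1, r.card_mid]
        · exact hdeg t
        · exact fun hh => r.mid_right _ (Finset.mem_of_mem_erase hh) hvE
    · apply Finset.eq_of_subset_of_card_le
      · intro b hb
        rw [SimpleGraph.mem_neighborFinset] at hb
        rcases r.symm.toIsSep.neighbor_mem hvE hb with h3 | h3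
        · rcases hEeq b h3 with rfl | rfl
          · exact absurd hb (G.loopless.irrefl _)
          · simp
        · simp only [Finset.mem_insert, Finset.mem_erase]
          refine Or.inr ⟨?_, h3⟩
          rintro rfl
          exact hqy hb.symm
      · rw [Finset.card_insert_of_notMem, Finset.card_erase_of_mem hq, r.card_mid]
        · exact hdeg v
        · exact fun hh => r.mid_right _ (Finset.mem_of_mem_erase hh) htE.2
  obtain ⟨C, R, E, r, hq, h1⟩ := hedge q y₁ hqy₁
  have hp : p ∈ R := h.pair_swap.pair_special hconn hdeg r hq hy₁ h1 hpy₁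
  have hTR := eq_singleton_of_card_one
    (h.pair_subset hconn r hp hq ⟨y₁, Finset.mem_inter.2 ⟨hy₁, h1⟩⟩).1
    (Finset.mem_inter.2 ⟨hy₁, h1⟩)
  rcases r.cover y₂ with h2 | h2 | h2
  · obtain ⟨t, ht⟩ := key r hp hq h1 h2
    exact ⟨R, t, r.card_mid, hp, hq, h1, ht⟩
  · have : y₂ ∈ T ∩ R := Finset.mem_inter.2 ⟨hy₂, h2⟩
    rw [hTR, Finset.mem_singleton] at this
    exact absurd this.symm k.pair_ne
  · obtain ⟨t, ht⟩ := key r.symm hp hq h1 h2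
    exact ⟨R, t, r.card_mid, hp, hq, h1, ht⟩

lemma exists_eq_of_card_five {X : Finset V} (hX : X.card = 5) {a b c d : V} (ha : a ∈ X) (hb : b ∈ X)
    (hc : c ∈ X) (hd : d ∈ X) (hab : a ≠ b) (hac : a ≠ c) (had : a ≠ d) (hbc : b ≠ c) (hbd : b ≠ d)
    (hcd : c ≠ d) : ∃ e, X = {a, b, c, d, e} := by
  have h1 : ((((X.erase a).erase b).erase c).erase d).card = 1 := by
    rw [Finset.card_erase_of_mem, Finset.card_erase_of_mem, Finset.card_erase_of_mem,
      Finset.card_erase_of_mem ha, hX] <;> simp [*, Ne.symm]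
  obtain ⟨e, he⟩ := Finset.card_eq_one.1 h1
  refine ⟨e, ?_⟩
  have hme : ∀ v, (v ≠ d ∧ v ≠ c ∧ v ≠ b ∧ v ≠ a ∧ v ∈ X) ↔ v = e := by
    intro v
    rw [← Finset.mem_singleton, ← he]
    simp only [Finset.mem_erase]
  ext v
  simp only [Finset.mem_insert, Finset.mem_singleton]
  rw [← hme]
  constructor
  · tauto
  · rintro (rfl | rfl | rfl | rfl | h) <;> tauto

lemma isSep_of_closed {W X : Finset V} (h : ∀ a ∈ W, ∀ b ∉ W ∪ X, ¬ G.Adj a b) :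
    IsSep G W (X \ W) (Finset.univ \ (W ∪ X)) := by
  refine ⟨fun v => ?_, fun v hv => ?_, fun v hv => ?_, fun v hv => ?_, fun a ha b hb => ?_⟩
  · simp only [Finset.mem_sdiff, Finset.mem_union, Finset.mem_univ, true_and]
    tauto
  · simp only [Finset.mem_sdiff]; tauto
  · simp only [Finset.mem_sdiff, Finset.mem_union]; tauto
  · simp only [Finset.mem_sdiff, Finset.mem_union] at *; tauto
  · exact h a ha b (Finset.mem_sdiff.1 hb).2

lemma false_of_adj_four (hdeg : ∀ v, 5 ≤ (G.neighborFinset v).card) (v a b c d : V)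
    (hv : ∀ u, G.Adj v u → u = a ∨ u = b ∨ u = c ∨ u = d) : False := by
  have h5 := hdeg v
  have h6 : G.neighborFinset v ⊆ {a, b, c, d} := by
    intro u hu
    rw [SimpleGraph.mem_neighborFinset] at hu
    simpa using hv u hu
  have h7 := (Finset.card_le_card h6).trans Finset.card_le_four
  omega

lemma ne_of_card_five {X : Finset V} {a b c d f : V} (hX : X.card = 5) (he : X = {a, b, c, d, f}) :
    f ≠ a ∧ f ≠ b ∧ f ≠ c ∧ f ≠ d := by
  have h4 : ¬ (X ⊆ {a, b, c, d}) := fun hs => by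
    have := (Finset.card_le_card hs).trans Finset.card_le_four
    omega
  refine ⟨?_, ?_, ?_, ?_⟩ <;>
  · rintro rfl
    apply h4
    rw [he]
    intro v
    simp only [Finset.mem_insert, Finset.mem_singleton]
    tauto

set_option maxHeartbeats 1000000 in
-- The configuration is symmetric in the two pairs, so `crossing_pairs` applies twice and yields `t`
-- and `e`. The seven known vertices have at most three outside neighbours, so the graph has at most
-- ten vertices, and one of the last ones has too small a degree.
lemma IsNSep.not_crossing_pairs {p q y₁ y₂ y : V} {T B S D : Finset V} (hconn : FiveConn G)
    (hdeg : ∀ v, 5 ≤ (G.neighborFinset v).card) (hedge : EdgesCovered G)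
    (h : IsNSep G {p, q} T B) (k : IsNSep G {y₁, y₂} S D) (hpS : p ∈ S) (hqS : q ∈ S)
    (hy₁ : y₁ ∈ T) (hy₂ : y₂ ∈ T) (hyT : y ∈ T) (hyS : y ∈ S)
    (hpy : G.Adj p y) (hqy : ¬ G.Adj q y) (hpy₁ : ¬ G.Adj p y₁) (hy₁y : G.Adj y₁ y)
    (hy₂y : ¬ G.Adj y₂ y) : False := by
  have hy₂p : G.Adj y₂ p := (k.pair_swap.pair_adj (hdeg _) hyS hy₂y).2 _ hpS hpy.ne
  obtain ⟨R, t, hR, hpR, hqR, hy₁R, htT, hty, hty₁, hty₂, hNt, hNy⟩ :=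
    h.crossing_pairs hconn hdeg hedge k hpS hqS hy₁ hy₂ hyT hyS hqy hpy₁ hy₁y hy₂y
  obtain ⟨R', e, hR', hy₁R', hy₂R', hpR', heS, hey, hep, heq, hNe, hNy'⟩ :=
    k.crossing_pairs hconn hdeg hedge h hy₁ hy₂ hpS hqS hyS hyT hy₂y (fun hh => hpy₁ hh.symm) hpy hqy
  have TS : T ∩ S = {y} := eq_singleton_of_card_one
    (h.pair_subset hconn k hpS hqS ⟨y, Finset.mem_inter.2 ⟨hyT, hyS⟩⟩).1
    (Finset.mem_inter.2 ⟨hyT, hyS⟩)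
  have hTS : ∀ v, v ∈ T → v ∈ S → v = y := fun v h1 h2 => by
    have : v ∈ T ∩ S := Finset.mem_inter.2 ⟨h1, h2⟩
    rwa [TS, Finset.mem_singleton] at this
  have hpq := h.pair_ne
  have hyy := k.pair_ne
  have hpT := h.pair_notMem
  have hqT := h.pair_swap.pair_notMem
  have hy₁S := k.pair_notMem
  have hy₂S := k.pair_swap.pair_notMem
  have ne1 : p ≠ y₁ := by rintro rfl; exact hpT hy₁
  have ne2 : p ≠ t := by rintro rfl; exact hpT htT
  have ne3 : y₁ ≠ e := by rintro rfl; exact hy₁S heS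
  have ne4 : t ≠ e := by rintro rfl; exact hty (hTS _ htT heS)
  have ne5 : q ≠ y₁ := by rintro rfl; exact hqT hy₁
  have ne6 : p ≠ y₂ := by rintro rfl; exact hpT hy₂
  have hyc : (G.neighborFinset y).card = 5 := by
    apply le_antisymm _ (hdeg y)
    rw [hNy]
    refine (Finset.card_insert_le _ _).trans ?_
    rw [Finset.card_erase_of_mem hqR, hR]
  obtain ⟨g, hg⟩ := exists_eq_of_card_five (a := p) (b := y₁) (c := t) (d := e) hyc
    (by rw [hNy]; simp [*]) (by rw [hNy]; simp [*, ne5.symm]) (by rw [hNy]; simp)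
    (by rw [hNy']; simp) ne1 ne2 hep.symm hty₁.symm ne3 ne4
  obtain ⟨t', ht'⟩ := exists_eq_of_card_five (a := y) (b := y₁) (c := y₂) (d := t) h.card_mid
    hyT hy₁ hy₂ htT hy₁y.ne.symm (by rintro rfl; exact hy₂S hyS) hty.symm hyy hty₁.symm hty₂.symm
  obtain ⟨e', he'⟩ := exists_eq_of_card_five (a := y) (b := p) (c := q) (d := e) k.card_mid
    hyS hpS hqS heS hpy.ne.symm (by rintro rfl; exact hqT hyT) hey.symm hpq hep.symm heq.symm
  have ay : ∀ v, G.Adj y v → v = p ∨ v = y₁ ∨ v = t ∨ v = e ∨ v = g := by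
    intro v hv
    rw [← SimpleGraph.mem_neighborFinset, hg] at hv
    simpa using hv
  have at' : ∀ v, G.Adj t v → v = y ∨ v = q ∨ v = p ∨ v = e ∨ v = g := by
    intro v hv
    have hvt := hv.ne
    rw [← SimpleGraph.mem_neighborFinset, hNt, Finset.mem_insert, Finset.mem_erase] at hv
    rcases hv with rfl | ⟨hv1, hv2⟩
    · simp
    by_cases hvq : v = q
    · simp [hvq]
    rcases ay v (by
      rw [← SimpleGraph.mem_neighborFinset, hNy]
      exact Finset.mem_insert_of_mem (Finset.mem_erase.2 ⟨hvq, hv2⟩)) with h | h | h | h | h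
    · simp [h]
    · exact absurd h hv1
    · exact absurd h.symm hvt
    · simp [h]
    · simp [h]
  have ae : ∀ v, G.Adj e v → v = y ∨ v = y₂ ∨ v = y₁ ∨ v = t ∨ v = g := by
    intro v hv
    have hvt := hv.ne
    rw [← SimpleGraph.mem_neighborFinset, hNe, Finset.mem_insert, Finset.mem_erase] at hv
    rcases hv with rfl | ⟨hv1, hv2⟩
    · simp
    by_cases hvq : v = y₂
    · simp [hvq]
    rcases ay v (by
      rw [← SimpleGraph.mem_neighborFinset, hNy']
      exact Finset.mem_insert_of_mem (Finset.mem_erase.2 ⟨hvq, hv2⟩)) with h | h | h | h | h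
    · exact absurd h hv1
    · simp [h]
    · simp [h]
    · exact absurd h.symm hvt
    · simp [h]
  have mT : ∀ v, v ∈ T ↔ v = y ∨ v = y₁ ∨ v = y₂ ∨ v = t ∨ v = t' := by
    intro v; rw [ht']; simp
  have mS : ∀ v, v ∈ S ↔ v = y ∨ v = p ∨ v = q ∨ v = e ∨ v = e' := by
    intro v; rw [he']; simp
  have ap : ∀ v, G.Adj p v → v = q ∨ v ∈ T := fun v hv => h.toIsSep.pair_neighbor hv
  have aq : ∀ v, G.Adj q v → v = p ∨ v ∈ T := fun v hv => h.pair_swap.toIsSep.pair_neighbor hv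
  have ay₁ : ∀ v, G.Adj y₁ v → v = y₂ ∨ v ∈ S := fun v hv => k.toIsSep.pair_neighbor hv
  have ay₂ : ∀ v, G.Adj y₂ v → v = y₁ ∨ v ∈ S := fun v hv => k.pair_swap.toIsSep.pair_neighbor hv
  set W : Finset V := {p, q, y₁, y₂, y, t, e} with hW
  have mW : ∀ v, v ∈ W ↔ v = p ∨ v = q ∨ v = y₁ ∨ v = y₂ ∨ v = y ∨ v = t ∨ v = e := by
    intro v; rw [hW]; simp
  have hsep : IsSep G W (({g, t', e'} : Finset V) \ W) (Finset.univ \ (W ∪ {g, t', e'})) := by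
    refine isSep_of_closed fun a ha b hb hab => ?_
    simp only [Finset.mem_union, not_or, mW, Finset.mem_insert, Finset.mem_singleton] at hb
    rw [mW] at ha
    obtain ⟨⟨b1, b2, b3, b4, b5, b6, b7⟩, b8, b9, b10⟩ := hb
    have nT : b ∉ T := fun hh => by
      rcases (mT b).1 hh with h1 | h1 | h1 | h1 | h1 <;> contradiction
    have nS : b ∉ S := fun hh => by
      rcases (mS b).1 hh with h1 | h1 | h1 | h1 | h1 <;> contradiction
    rcases ha with h0 | h0 | h0 | h0 | h0 | h0 | h0 <;> rw [h0] at hab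
    · rcases ap b hab with h1 | h1 <;> contradiction
    · rcases aq b hab with h1 | h1 <;> contradiction
    · rcases ay₁ b hab with h1 | h1 <;> contradiction
    · rcases ay₂ b hab with h1 | h1 <;> contradiction
    · rcases ay b hab with h1 | h1 | h1 | h1 | h1 <;> contradiction
    · rcases at' b hab with h1 | h1 | h1 | h1 | h1 <;> contradiction
    · rcases ae b hab with h1 | h1 | h1 | h1 | h1 <;> contradiction
  have hall : ∀ v, v ∈ W ∨ v = g ∨ v = t' ∨ v = e' := by
    by_contra! hne
    obtain ⟨v, hv1, hv2, hv3, hv4⟩ := hne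
    have h5 := hconn _ _ _ hsep ⟨p, by simp [hW]⟩ ⟨v, by
      simp only [Finset.mem_sdiff, Finset.mem_univ, true_and, Finset.mem_union, not_or,
        Finset.mem_insert, Finset.mem_singleton]
      exact ⟨hv1, hv2, hv3, hv4⟩⟩
    have h6 : (({g, t', e'} : Finset V) \ W).card ≤ 3 :=
      (Finset.card_le_card Finset.sdiff_subset).trans Finset.card_le_three
    omega
  have four := @false_of_adj_four V _ _ G _ hdeg
  obtain ⟨s1, s2, s3, s4⟩ := ne_of_card_five h.card_mid ht'
  obtain ⟨s5, s6, s7, s8⟩ := ne_of_card_five k.card_mid he'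
  have ht'T : t' ∈ T := (mT t').2 (by simp)
  have he'S : e' ∈ S := (mS e').2 (by simp)
  have ht'S : t' ∉ S := fun hh => s1 (hTS _ ht'T hh)
  have he'T : e' ∉ T := fun hh => s5 (hTS _ hh he'S)
  have heT : e ∉ T := fun hh => hey (hTS _ hh heS)
  have htS : t ∉ S := fun hh => hty (hTS _ htT hh)
  have s9 : t' ≠ p := fun hh => hpT (hh ▸ ht'T)
  have s10 : t' ≠ q := fun hh => hqT (hh ▸ ht'T)
  have s11 : t' ≠ e := fun hh => heT (hh ▸ ht'T)
  have s12 : e' ≠ y₁ := fun hh => hy₁S (hh ▸ he'S)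
  have s13 : e' ≠ y₂ := fun hh => hy₂S (hh ▸ he'S)
  have s14 : e' ≠ t := fun hh => htS (hh ▸ he'S)
  have s15 : e' ≠ t' := fun hh => ht'S (hh ▸ he'S)
  -- The vertex `g`, the fifth neighbour of `y`, may coincide with `t'` or `e'`. Whichever of these
  -- two differs from `g` has at most four possible neighbours.
  by_cases htg : t' = g
  · have s16 : e' ≠ g := fun hh => s15 (hh.trans htg.symm)
    apply four e' y₁ y₂ g t'
    intro u hu
    rcases hall u with h1 | h1 | h1 | h1
    · rcases (mW u).1 h1 with h1 | h1 | h1 | h1 | h1 | h1 | h1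
      · rcases ap _ (h1 ▸ hu.symm) with h2 | h2 <;> contradiction
      · rcases aq _ (h1 ▸ hu.symm) with h2 | h2 <;> contradiction
      · exact Or.inl h1
      · exact Or.inr (Or.inl h1)
      · rcases ay _ (h1 ▸ hu.symm) with h2 | h2 | h2 | h2 | h2 <;> contradiction
      · rcases at' _ (h1 ▸ hu.symm) with h2 | h2 | h2 | h2 | h2 <;> contradiction
      · rcases ae _ (h1 ▸ hu.symm) with h2 | h2 | h2 | h2 | h2 <;> contradiction
    · exact Or.inr (Or.inr (Or.inl h1))
    · exact Or.inr (Or.inr (Or.inr h1))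
    · exact absurd h1.symm hu.ne
  · apply four t' p q g e'
    intro u hu
    rcases hall u with h1 | h1 | h1 | h1
    · rcases (mW u).1 h1 with h1 | h1 | h1 | h1 | h1 | h1 | h1
      · exact Or.inl h1
      · exact Or.inr (Or.inl h1)
      · rcases ay₁ _ (h1 ▸ hu.symm) with h2 | h2 <;> contradiction
      · rcases ay₂ _ (h1 ▸ hu.symm) with h2 | h2 <;> contradiction
      · rcases ay _ (h1 ▸ hu.symm) with h2 | h2 | h2 | h2 | h2 <;> contradiction
      · rcases at' _ (h1 ▸ hu.symm) with h2 | h2 | h2 | h2 | h2 <;> contradiction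
      · rcases ae _ (h1 ▸ hu.symm) with h2 | h2 | h2 | h2 | h2 <;> contradiction
    · exact Or.inr (Or.inr (Or.inl h1))
    · exact absurd h1.symm hu.ne
    · exact Or.inr (Or.inr (Or.inr h1))

lemma eq_pair_of_card_two {X : Finset V} (hX : X.card = 2) {a : V} (ha : a ∈ X) :
    ∃ b ≠ a, X = {a, b} := by
  obtain ⟨b, hb⟩ := Finset.card_eq_one.1 (by rw [Finset.card_erase_of_mem ha, hX] :
    (X.erase a).card = 1)
  have hbm : b ∈ X.erase a := by rw [hb]; simp
  refine ⟨b, (Finset.mem_erase.1 hbm).1, ?_⟩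
  rw [← Finset.insert_erase ha, hb]

/-- Here `C` is itself a pair `{y', t}` inside `T`, with `p`, `q`, `y` in its boundary. The aim is
to show that `t` misses `y` while `y'` does not, which is the configuration of `not_crossing_pairs`.
-/
lemma IsNSep.false_of_private_of_card_two {p q y y' : V} {T B C R D : Finset V}
    (hconn : FiveConn G) (hdeg : ∀ v, 5 ≤ (G.neighborFinset v).card) (hedge : EdgesCovered G)
    (h : IsNSep G {p, q} T B) (k : IsNSep G C R D) (hp : p ∈ R) (hq : q ∈ R) (hy : y ∈ R)
    (hyT : y ∈ T) (hyT' : y' ∈ T) (hpy : G.Adj p y) (hqy : ¬ G.Adj q y) (hqy' : G.Adj q y')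
    (hpy' : ¬ G.Adj p y') (hyC : y' ∈ C) (hC : C.card = 2) : False := by
  obtain ⟨b1, b2, b3⟩ := h.pair_subset hconn k hp hq ⟨y, Finset.mem_inter.2 ⟨hyT, hy⟩⟩
  have hCT : C ⊆ T := by
    have : T ∩ C = C := Finset.eq_of_subset_of_card_le Finset.inter_subset_right (by omega)
    rw [← this]; exact Finset.inter_subset_left
  obtain ⟨t, hty', rfl⟩ := eq_pair_of_card_two hC hyC
  have htT : t ∈ T := hCT (by simp)
  have hty : t ≠ y := by rintro rfl; exact k.left_mid t (by simp) hy
  have hpall := h.pair_adj (hdeg _) hyT' hpy'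
  have hqall := h.pair_swap.pair_adj (hdeg _) hyT hqy
  have hpt : G.Adj p t := hpall.2 t htT hty'
  have hqt : G.Adj q t := hqall.2 t htT hty
  have hv : ∃ v ∈ R, G.Adj y' v ∧ ¬ G.Adj t v := by
    obtain ⟨C', R', D', k', hq', hy''⟩ := hedge q y' hqy'
    have hp' : p ∈ R' := h.pair_swap.pair_special hconn hdeg k' hq' hyT' hy'' hpy'
    have hTR := eq_singleton_of_card_one
      (h.pair_subset hconn k' hp' hq' ⟨y', Finset.mem_inter.2 ⟨hyT', hy''⟩⟩).1
      (Finset.mem_inter.2 ⟨hyT', hy''⟩)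
    rcases k'.cover t with h1 | h1 | h1
    · obtain ⟨v, hv, -, hv'⟩ := k.pair_split hconn hdeg k' hy'' h1
      exact ⟨v, hv, hv'⟩
    · have : t ∈ T ∩ R' := Finset.mem_inter.2 ⟨htT, h1⟩
      rw [hTR, Finset.mem_singleton] at this
      exact absurd this hty'
    · obtain ⟨v, hv, -, hv'⟩ := k.pair_split hconn hdeg k'.symm hy'' h1
      exact ⟨v, hv, hv'⟩
  obtain ⟨v, hvR, hyv, htv⟩ := hv
  -- A separation through `y'`, `t` and `v ≠ y` has two vertices of `R` on each side, but `q` and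
  -- `y` are neighbours of `p` and so the three lie on the same side.
  have hvy : v = y := by
    by_contra hne
    obtain ⟨C₁, R₁, D₁, r, hy₁, hv₁⟩ := hedge y' v hyv
    have ht₁ : t ∈ R₁ := k.pair_special hconn hdeg r hy₁ hvR hv₁ htv
    obtain ⟨c1, c2, c3⟩ := k.pair_subset hconn r hy₁ ht₁ ⟨v, Finset.mem_inter.2 ⟨hvR, hv₁⟩⟩
    have hRR := eq_singleton_of_card_one c1 (Finset.mem_inter.2 ⟨hvR, hv₁⟩)
    have hout : ∀ u ∈ R, u ≠ v → u ∉ R₁ := fun u hu hne hu₁ => by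
      have : u ∈ R ∩ R₁ := Finset.mem_inter.2 ⟨hu, hu₁⟩
      rw [hRR, Finset.mem_singleton] at this
      exact hne this
    have hqR : q ∉ R₁ := hout q hq (by rintro rfl; exact htv hqt.symm)
    have hpR : p ∉ R₁ := hout p hp (by rintro rfl; exact htv hpt.symm)
    have hyR : y ∉ R₁ := hout y hy (Ne.symm hne)
    have key : ∀ {C₁ D₁ : Finset V}, IsNSep G C₁ R₁ D₁ → (R ∩ C₁).card = 2 → p ∉ C₁ := by
      intro C₁ D₁ r c2 hpC
      have hqC : q ∈ C₁ := (r.toIsSep.neighbor_mem hpC hpall.1).resolve_right hqR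
      have hyC : y ∈ C₁ := (r.toIsSep.neighbor_mem hpC hpy).resolve_right hyR
      have hs : ({p, q, y} : Finset V) ⊆ R ∩ C₁ := by
        intro u
        simp only [Finset.mem_insert, Finset.mem_singleton, Finset.mem_inter]
        rintro (rfl | rfl | rfl) <;> constructor <;> assumption
      have := Finset.card_le_card hs
      have hqy : q ≠ y := by rintro rfl; exact h.pair_swap.pair_notMem hyT
      rw [Finset.card_eq_three.2 ⟨p, q, y, h.pair_ne, hpy.ne, hqy, rfl⟩] at this
      omega
    rcases r.cover p with h1 | h1 | h1
    · exact key r c2 h1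
    · exact hpR h1
    · exact key r.symm c3 h1
  subst hvy
  exact h.not_crossing_pairs hconn hdeg hedge k hp hq hyT' htT hyT hy hpy hqy hpy' hyv htv

/-- In a pair, one neighbourhood in the boundary contains the other. -/
lemma IsNSep.not_private {p q y y' : V} {T B : Finset V}
    (hconn : FiveConn G) (hdeg : ∀ v, 5 ≤ (G.neighborFinset v).card) (hedge : EdgesCovered G)
    (h : IsNSep G {p, q} T B) (hyT : y ∈ T) (hyT' : y' ∈ T) (hpy : G.Adj p y)
    (hqy : ¬ G.Adj q y) (hqy' : G.Adj q y') : G.Adj p y' := by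
  by_contra hpy'
  have hne : y ≠ y' := by rintro rfl; exact hqy hqy'
  obtain ⟨C, R, D, k, hp, hy⟩ := hedge p y hpy
  obtain ⟨C', R', D', k', hq', hy'⟩ := hedge q y' hqy'
  have hq : q ∈ R := h.pair_special hconn hdeg k hp hyT hy hqy
  have hp' : p ∈ R' := h.pair_swap.pair_special hconn hdeg k' hq' hyT' hy' hpy'
  have hTR := eq_singleton_of_card_one
    (h.pair_subset hconn k hp hq ⟨y, Finset.mem_inter.2 ⟨hyT, hy⟩⟩).1
    (Finset.mem_inter.2 ⟨hyT, hy⟩)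
  have hTR' := eq_singleton_of_card_one
    (h.pair_subset hconn k' hp' hq' ⟨y', Finset.mem_inter.2 ⟨hyT', hy'⟩⟩).1
    (Finset.mem_inter.2 ⟨hyT', hy'⟩)
  have hn1 : y' ∉ R := fun hh => by
    have : y' ∈ T ∩ R := Finset.mem_inter.2 ⟨hyT', hh⟩
    rw [hTR, Finset.mem_singleton] at this
    exact hne this.symm
  have hn2 : y ∉ R' := fun hh => by
    have : y ∈ T ∩ R' := Finset.mem_inter.2 ⟨hyT, hh⟩
    rw [hTR', Finset.mem_singleton] at this
    exact hne this
  have key : ∀ {C D C' D' : Finset V}, IsNSep G C R D → IsNSep G C' R' D' → y' ∈ C → y ∈ C' →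
      False := by
    intro C D C' D' k k' h1 h2
    rcases h.card_eq_two_of_cross hconn k k' hp hq hy hp' hq' hy' hyT hyT' h2 h1 with hc | hc
    · exact h.false_of_private_of_card_two hconn hdeg hedge k hp hq hy hyT hyT' hpy hqy hqy' hpy'
        h1 hc
    · exact h.pair_swap.false_of_private_of_card_two hconn hdeg hedge k' hq' hp' hy' hyT' hyT hqy'
        hpy' hpy hqy h2 hc
  rcases k.cover y' with h1 | h1 | h1
  · rcases k'.cover y with h2 | h2 | h2
    · exact key k k' h1 h2
    · exact hn2 h2
    · exact key k k'.symm h1 h2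
  · exact hn1 h1
  · rcases k'.cover y with h2 | h2 | h2
    · exact key k.symm k' h1 h2
    · exact hn2 h2
    · exact key k.symm k'.symm h1 h2

lemma IsNSep.pair_le_or_le {p q : V} {T B : Finset V}
    (hconn : FiveConn G) (hdeg : ∀ v, 5 ≤ (G.neighborFinset v).card) (hedge : EdgesCovered G)
    (h : IsNSep G {p, q} T B) :
    (∀ v ∈ T, G.Adj q v → G.Adj p v) ∨ (∀ v ∈ T, G.Adj p v → G.Adj q v) := by
  by_contra! hn
  obtain ⟨⟨y', hyT', hqy', hpy'⟩, y, hyT, hpy, hqy⟩ := hn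
  exact hpy' (h.not_private hconn hdeg hedge hyT hyT' hpy hqy hqy')

/-- Every boundary vertex of a pair lies with the pair in the middle of a nontrivial separation. -/
lemma IsNSep.exists_pair_subset {p q x : V} {T B : Finset V}
    (hconn : FiveConn G) (hdeg : ∀ v, 5 ≤ (G.neighborFinset v).card) (hedge : EdgesCovered G)
    (h : IsNSep G {p, q} T B) (hx : x ∈ T) :
    ∃ C R D : Finset V, IsNSep G C R D ∧ p ∈ R ∧ q ∈ R ∧ x ∈ R := by
  have key : ∀ {p q : V}, IsNSep G {p, q} T B → (∀ v ∈ T, G.Adj q v → G.Adj p v) →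
      ∃ C R D : Finset V, IsNSep G C R D ∧ p ∈ R ∧ q ∈ R ∧ x ∈ R := by
    intro p q h hle
    by_cases hqx : G.Adj q x
    · obtain ⟨C, R, D, k, hq, hxR⟩ := hedge q x hqx
      refine ⟨C, R, D, k, ?_, hq, hxR⟩
      rcases k.cover p with h1 | h1 | h1
      · obtain ⟨y, hy, -, h2, h3⟩ := h.pair_swap.pair_split hconn hdeg k hq h1
        exact absurd (hle y hy h2) h3
      · exact h1
      · obtain ⟨y, hy, -, h2, h3⟩ := h.pair_swap.pair_split hconn hdeg k.symm hq h1
        exact absurd (hle y hy h2) h3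
    · obtain ⟨a, ha, hxa⟩ := (h.exists_adj_of_conn hconn hx).1
      simp only [Finset.mem_insert, Finset.mem_singleton] at ha
      rcases ha with rfl | rfl
      · obtain ⟨C, R, D, k, hp, hxR⟩ := hedge a x hxa.symm
        exact ⟨C, R, D, k, hp, h.pair_special hconn hdeg k hp hx hxR hqx, hxR⟩
      · exact absurd hxa.symm hqx
  rcases h.pair_le_or_le hconn hdeg hedge with hle | hle
  · exact key h hle
  · obtain ⟨C, R, D, k, h1, h2, h3⟩ := key h.pair_swap hle
    exact ⟨C, R, D, k, h2, h1, h3⟩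

/-! ### Contradiction in the 5-connected case. -/

/-- A counterpart of `cross_of_min` for separations through a fixed pair: minimality is only
available for middles containing that pair, so its consequences enter as hypotheses on
cardinalities. -/
lemma IsNSep.cross_of_pair_min {C S D C' R D' : Finset V} (hconn : FiveConn G)
    (k : IsNSep G C S D) (k' : IsNSep G C' R D')
    (ha : 1 ≤ (C ∩ R).card) (hb : 2 ≤ (S ∩ R).card)
    (c1 : 2 ≤ (C ∩ C').card → (C ∩ R).card + (S ∩ R).card + (S ∩ C').card ≠ 5)
    (c2 : 2 ≤ (C ∩ D').card → (C ∩ R).card + (S ∩ R).card + (S ∩ D').card ≠ 5)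
    (m1 : C.card ≤ D.card) (m2 : C.card ≤ C'.card) (m3 : C.card ≤ D'.card) :
    C.card = 2 ∨ (C.card = 3 ∧ (C ∩ C').card = 1 ∧ (C ∩ D').card = 1 ∧
      (C ∩ R).card + (S ∩ R).card + (S ∩ C').card = 5 ∧
      (C ∩ R).card + (S ∩ R).card + (S ∩ D').card = 5) := by
  obtain ⟨⟨e1, e2, e3⟩, e4, e5, e6⟩ := k.cells k'
  have d1 := k.card_corner_of_conn hconn k'
  have d2 := k.card_corner_of_conn hconn k'.symm
  have d3 := k.symm.card_corner_of_conn hconn k'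
  have d4 := k.symm.card_corner_of_conn hconn k'.symm
  have := k.two_le_left
  clear hconn k k'
  generalize (C ∩ C').card = f1 at *
  generalize (C ∩ R).card = a at *
  generalize (C ∩ D').card = f2 at *
  generalize (S ∩ C').card = c at *
  generalize (S ∩ R).card = b at *
  generalize (S ∩ D').card = d at *
  generalize (D ∩ C').card = g1 at *
  generalize (D ∩ R).card = e at *
  generalize (D ∩ D').card = g2 at *
  generalize C.card = m at *
  generalize D.card = mb at *
  generalize C'.card = mc at *
  generalize D'.card = md at *
  replace d1 : f1 = 0 ∨ f1 = 1 ∧ 5 ≤ a + b + c ∨ 2 ≤ f1 ∧ 6 ≤ a + b + c := by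
    by_cases h2 : 2 ≤ f1
    · have := c1 h2; have := d1 (by omega); omega
    · omega
  replace d2 : f2 = 0 ∨ f2 = 1 ∧ 5 ≤ a + b + d ∨ 2 ≤ f2 ∧ 6 ≤ a + b + d := by
    by_cases h2 : 2 ≤ f2
    · have := c2 h2; have := d2 (by omega); omega
    · omega
  replace d3 : g1 = 0 ∨ 5 ≤ e + b + c := by omega
  replace d4 : g2 = 0 ∨ 5 ≤ e + b + d := by omega
  clear c1 c2
  rcases d1 with rfl | ⟨rfl, d1⟩ | ⟨d0, d1⟩ <;> rcases d2 with rfl | ⟨rfl, d2⟩ | ⟨d0', d2⟩ <;>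
    rcases d3 with rfl | d3 <;> rcases d4 with rfl | d4 <;> omega

/-- A 5-connected graph has an edge that lies in no nontrivial separation of order five. -/
theorem not_edgesCovered (hconn : FiveConn G) (hdeg : ∀ v, 5 ≤ (G.neighborFinset v).card)
    (hne : ∃ A S B : Finset V, IsNSep G A S B) : ¬ EdgesCovered G := by
  intro hedge
  obtain ⟨p₀, q₀, T₀, B₀, h₀⟩ : ∃ p q, ∃ T B : Finset V, IsNSep G {p, q} T B := by
    have hex : ∃ n, ∃ A S B : Finset V, IsNSep G A S B ∧ A.card = n := by
      obtain ⟨A, S, B, h⟩ := hne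
      exact ⟨_, A, S, B, h, rfl⟩
    classical
    obtain ⟨F, T, B, h, hF⟩ := Nat.find_spec hex
    have h2 : F.card = 2 := h.card_eq_two_of_min hconn hdeg hedge (fun A S B hA => by
      rw [hF]; exact Nat.find_min' hex ⟨A, S, B, hA, rfl⟩)
    obtain ⟨a, b, -, rfl⟩ := Finset.card_eq_two.1 h2
    exact ⟨a, b, T, B, h⟩
  have hex : ∃ n, ∃ p q, ∃ T B C S D : Finset V, IsNSep G {p, q} T B ∧ IsNSep G C S D ∧ p ∈ S ∧
      q ∈ S ∧ (T ∩ S).Nonempty ∧ C.card = n := by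
    obtain ⟨x, hx⟩ := Finset.card_pos.1 (by rw [h₀.card_mid]; norm_num : 0 < T₀.card)
    obtain ⟨C, R, D, k, h1, h2, h3⟩ := h₀.exists_pair_subset hconn hdeg hedge hx
    exact ⟨_, p₀, q₀, T₀, B₀, C, R, D, h₀, k, h1, h2, ⟨x, Finset.mem_inter.2 ⟨hx, h3⟩⟩, rfl⟩
  classical
  obtain ⟨p, q, T, B, C, S, D, h, k, hp, hq, hTS, hC⟩ := Nat.find_spec hex
  have hmin : ∀ {C' S' D' : Finset V}, IsNSep G C' S' D' → p ∈ S' → q ∈ S' → (T ∩ S').Nonempty →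
      C.card ≤ C'.card := by
    intro C' S' D' k' hp' hq' hT'
    rw [hC]
    exact Nat.find_min' hex ⟨p, q, T, B, C', S', D', h, k', hp', hq', hT', rfl⟩
  obtain ⟨b1, b2, b3⟩ := h.pair_subset hconn k hp hq hTS
  obtain ⟨y₁, hy₁⟩ := Finset.card_pos.1 (by omega : 0 < (T ∩ C).card)
  rw [Finset.mem_inter] at hy₁
  obtain ⟨C', R, D', k', hp', hq', hyR⟩ := h.exists_pair_subset hconn hdeg hedge hy₁.1
  have hTR : (T ∩ R).Nonempty := ⟨y₁, Finset.mem_inter.2 ⟨hy₁.1, hyR⟩⟩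
  -- The middle of this corner still contains `p`, `q` and `y₁`, and the corner omits `y₁ ∈ C`, so
  -- it would contradict the minimality of `C`.
  have corner : ∀ {C' D' : Finset V}, IsNSep G C' R D' → 2 ≤ (C ∩ C').card →
      (C ∩ R).card + (S ∩ R).card + (S ∩ C').card ≠ 5 := by
    intro C' D' k' h2 h5
    rw [← k.toIsSep.card_corner k'.toIsSep] at h5
    have := hmin ⟨k.toIsSep.corner k'.toIsSep, h5, h2,
      k.two_le_right.trans (Finset.card_le_card Finset.subset_union_left)⟩
      (mem_cornerMid.2 (by tauto)) (mem_cornerMid.2 (by tauto))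
      ⟨y₁, Finset.mem_inter.2 ⟨hy₁.1, mem_cornerMid.2 (by tauto)⟩⟩
    have hlt : (C ∩ C').card < C.card := Finset.card_lt_card
      ⟨Finset.inter_subset_left, fun hs =>
        k'.left_mid _ (Finset.mem_inter.1 (hs hy₁.2)).2 hyR⟩
    omega
  have hb : 2 ≤ (S ∩ R).card := by
    rw [← Finset.card_pair h.pair_ne]
    apply Finset.card_le_card
    intro v; simp only [Finset.mem_insert, Finset.mem_singleton, Finset.mem_inter]
    rintro (rfl | rfl) <;> constructor <;> assumption
  have hC2 : C.card = 2 := by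
    rcases k.cross_of_pair_min hconn k'
      (Finset.card_pos.2 ⟨y₁, Finset.mem_inter.2 ⟨hy₁.2, hyR⟩⟩) hb (corner k') (corner k'.symm)
      (hmin k.symm hp hq hTS) (hmin k' hp' hq' hTR) (hmin k'.symm hp' hq' hTR) with
      hc | ⟨hc, f1, f2, t1, t2⟩
    · exact hc
    · exfalso
      -- The single vertex of each corner is adjacent to `p`, hence lies in `T`. With `y₁` this puts
      -- three vertices into `T ∩ C`, which has two.
      have single : ∀ {C' D' : Finset V}, IsNSep G C' R D' → (C ∩ C').card = 1 →
          (C ∩ R).card + (S ∩ R).card + (S ∩ C').card = 5 → ∃ w, w ∈ T ∩ C ∧ w ∈ C' := by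
        intro C' D' k' f1 t1
        obtain ⟨w, hw⟩ := Finset.card_eq_one.1 f1
        have hN := k.toIsSep.neighborFinset_eq_cornerMid hdeg k'.toIsSep hw t1
        have hwm : w ∈ C ∩ C' := hw ▸ Finset.mem_singleton_self w
        rw [Finset.mem_inter] at hwm
        have hpw : G.Adj p w := by
          rw [G.adj_comm, ← SimpleGraph.mem_neighborFinset, hN, mem_cornerMid]; tauto
        refine ⟨w, Finset.mem_inter.2 ⟨?_, hwm.1⟩, hwm.2⟩
        rcases h.toIsSep.pair_neighbor hpw with rfl | h1
        · exact absurd hq (k.left_mid _ hwm.1)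
        · exact h1
      obtain ⟨w, hw1, hw2⟩ := single k' f1 t1
      obtain ⟨w', hw1', hw2'⟩ := single k'.symm f2 t2
      have hs : ({y₁, w, w'} : Finset V) ⊆ T ∩ C := by
        intro u
        simp only [Finset.mem_insert, Finset.mem_singleton]
        rintro (rfl | rfl | rfl)
        · exact Finset.mem_inter.2 hy₁
        · assumption
        · assumption
      have hle := Finset.card_le_card hs
      rw [Finset.card_eq_three.2 ⟨y₁, w, w', ?_, ?_, ?_, rfl⟩] at hle
      · omega
      · rintro rfl; exact k'.left_mid _ hw2 hyR
      · rintro rfl; exact k'.mid_right _ hyR hw2'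
      · rintro rfl; exact k'.left_right _ hw2 hw2'
  have hCT : C ⊆ T := by
    have : T ∩ C = C := Finset.eq_of_subset_of_card_le Finset.inter_subset_right (by omega)
    rw [← this]; exact Finset.inter_subset_left
  obtain ⟨y₂, hne, rfl⟩ := eq_pair_of_card_two hC2 hy₁.2
  have hy₂ : y₂ ∈ T := hCT (by simp)
  -- A separation through `y₁`, `y₂`, `q` cannot have `p` in its middle, which would meet `T` twice.
  -- With `p` on a side, `q` has a neighbour in `T` that `p` misses.
  have final : ∀ {p q : V}, IsNSep G {p, q} T B → q ∈ S → ¬ (∀ v ∈ T, G.Adj q v → G.Adj p v) := by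
    intro p q h hq hle
    obtain ⟨C', R, D', r, h1, h2, hqR⟩ := k.exists_pair_subset hconn hdeg hedge hq
    rcases r.cover p with h3 | h3 | h3
    · obtain ⟨y, hy, -, h4, h5⟩ := h.pair_swap.pair_split hconn hdeg r hqR h3
      exact h5 (hle y hy h4)
    · have := (h.pair_subset hconn r h3 hqR ⟨y₁, Finset.mem_inter.2 ⟨hy₁.1, h1⟩⟩).1
      exact hne (Finset.card_le_one.1 this.le _ (Finset.mem_inter.2 ⟨hy₂, h2⟩) _
        (Finset.mem_inter.2 ⟨hy₁.1, h1⟩))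
    · obtain ⟨y, hy, -, h4, h5⟩ := h.pair_swap.pair_split hconn hdeg r.symm hqR h3
      exact h5 (hle y hy h4)
  rcases h.pair_le_or_le hconn hdeg hedge with hle | hle
  · exact final h hq hle
  · exact final h.pair_swap hp hle

/-! ### Vertices of degree four. -/

/-- A quasi 5-connected graph without quasi 5-contractible edges in which the vertices of degree
four are far apart, expressed through separations. -/
structure Critical (G : SimpleGraph V) [DecidableRel G.Adj] : Prop where
  four : ∀ A S B : Finset V, IsSep G A S B → A.Nonempty → B.Nonempty → 4 ≤ S.card
  quasi : QuasiFive G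
  deg : ∀ v, 4 ≤ (G.neighborFinset v).card
  sparse_adj : ∀ a b, (G.neighborFinset a).card = 4 → G.Adj a b → 5 ≤ (G.neighborFinset b).card
  sparse : ∀ a b c, (G.neighborFinset a).card = 4 → a ≠ b → G.Adj a c → G.Adj b c →
    5 ≤ (G.neighborFinset b).card
  edge : ∀ x y, G.Adj x y → (∃ w, (G.neighborFinset w).card = 4 ∧ G.Adj w x ∧ G.Adj w y) ∨
    ∃ A S B : Finset V, IsNSep G A S B ∧ x ∈ S ∧ y ∈ S

namespace Critical

variable {z : V} {A S B C R D : Finset V}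

/-- A separation of order four cuts off a single vertex. -/
lemma eq_singleton (cr : Critical G) (h : IsSep G A S B) (hS : S.card = 4) (hA : A.Nonempty)
    (hB : 2 ≤ B.card) : ∃ w, A = {w} ∧ G.neighborFinset w = S := by
  have h1 : A.card = 1 := by
    have := Finset.card_pos.2 hA
    by_contra hne
    have := cr.quasi _ _ _ h (by omega) hB
    omega
  obtain ⟨w, rfl⟩ := Finset.card_eq_one.1 h1
  refine ⟨w, rfl, Finset.eq_of_subset_of_card_le (fun v hv => ?_) (by rw [hS]; exact cr.deg w)⟩
  rw [SimpleGraph.mem_neighborFinset] at hv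
  rcases h.neighbor_mem (by simp) hv with h1 | h1
  · rw [Finset.mem_singleton] at h1
    exact absurd h1.symm hv.ne
  · exact h1

/-- A separation through a vertex of degree four has order at least five. -/
lemma five_le (cr : Critical G) (hz : (G.neighborFinset z).card = 4) (h : IsSep G A S B)
    (hzS : z ∈ S) (hA : A.Nonempty) (hB : B.Nonempty) : 5 ≤ S.card := by
  have h4 := cr.four _ _ _ h hA hB
  by_contra hlt
  have hS : S.card = 4 := by omega
  have key : ∀ {w : V}, G.neighborFinset w = S → False := by
    intro w hw
    have hwz : G.Adj z w := by rwa [G.adj_comm, ← SimpleGraph.mem_neighborFinset, hw]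
    have := cr.sparse_adj z w hz hwz
    rw [hw] at this
    omega
  by_cases hB2 : 2 ≤ B.card
  · obtain ⟨w, -, hw⟩ := cr.eq_singleton h hS hA hB2
    exact key hw
  · by_cases hA2 : 2 ≤ A.card
    · obtain ⟨w, -, hw⟩ := cr.eq_singleton h.symm hS hB hA2
      exact key hw
    · obtain ⟨w, rfl⟩ := Finset.card_eq_one.1
        (by have := Finset.card_pos.2 hA; omega : A.card = 1)
      refine key (w := w) (Finset.eq_of_subset_of_card_le (fun v hv => ?_)
        (by rw [hS]; exact cr.deg w))
      rw [SimpleGraph.mem_neighborFinset] at hv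
      rcases h.neighbor_mem (by simp) hv with h1 | h1
      · rw [Finset.mem_singleton] at h1
        exact absurd h1.symm hv.ne
      · exact h1

/-- The triangle alternative would put a second vertex of degree four next to `z`. -/
lemma star (cr : Critical G) (hz : (G.neighborFinset z).card = 4) {x : V} (hx : G.Adj z x) :
    ∃ A S B : Finset V, IsNSep G A S B ∧ z ∈ S ∧ x ∈ S := by
  rcases cr.edge z x hx with ⟨w, hw, hwz, -⟩ | h
  · have := cr.sparse_adj w z hw hwz
    omega
  · exact h

/-- A nontrivial separation through a vertex `z` of degree four with only one neighbour `x` of `z`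
on the left is crossed in a unique way by the separations through the edge `zx`. -/
lemma cross (cr : Critical G) (hz : (G.neighborFinset z).card = 4) {x : V}
    (h : IsNSep G A S B) (hzS : z ∈ S) (hxA : x ∈ A) (hzx : G.Adj z x)
    (huniq : ∀ a ∈ A, G.Adj z a → a = x) (k : IsNSep G C R D) (hzR : z ∈ R) (hxR : x ∈ R) :
    A.card = 2 ∧ A ⊆ R ∧ (S ∩ R).card = 1 ∧ (S ∩ C).card = 2 ∧ (S ∩ D).card = 2 ∧
      (B ∩ R).card = 2 := by
  have left : ∀ {C D : Finset V}, IsNSep G C R D → (A ∩ C).card = 0 ∨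
      6 ≤ (A ∩ R).card + (S ∩ R).card + (S ∩ C).card := by
    intro C D k
    by_contra! hlt
    have hAC : (A ∩ C).Nonempty := Finset.card_pos.1 (by omega)
    have hs := h.toIsSep.corner k.toIsSep
    have hzm : z ∈ cornerMid A S C R := mem_cornerMid.2 (by tauto)
    have hxm : x ∈ cornerMid A S C R := mem_cornerMid.2 (by tauto)
    have hB2 : 2 ≤ (B ∪ D).card :=
      h.two_le_right.trans (Finset.card_le_card Finset.subset_union_left)
    have h5 := cr.five_le hz hs hzm hAC (Finset.card_pos.1 (by omega))
    have hc := h.toIsSep.card_corner k.toIsSep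
    have hm : (cornerMid A S C R).card = 5 := by omega
    -- A corner with two vertices would contain a neighbour of `z`, but the only candidate `x` is in
    -- `R`. A single corner vertex would have degree four and share the neighbour `x` with `z`.
    by_cases h2 : 2 ≤ (A ∩ C).card
    · obtain ⟨a, ha, hza⟩ := IsNSep.exists_adj_left cr.quasi ⟨hs, hm, h2, hB2⟩ hzm
      rw [Finset.mem_inter] at ha
      have := huniq a ha.1 hza
      subst this
      exact k.left_mid _ ha.2 hxR
    · obtain ⟨w, hw⟩ := Finset.card_eq_one.1 (by omega : (A ∩ C).card = 1)
      have hwm : w ∈ A ∩ C := by rw [hw]; simp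
      have hwA := (Finset.mem_inter.1 hwm).1
      have hwx : w ≠ x := by
        rintro rfl; exact k.left_mid _ (Finset.mem_inter.1 hwm).2 hxR
      have hwz : w ≠ z := by rintro rfl; exact h.left_mid _ hwA hzS
      have heq : G.neighborFinset w = (cornerMid A S C R).erase z := by
        apply Finset.eq_of_subset_of_card_le
        · intro v hv
          rw [SimpleGraph.mem_neighborFinset] at hv
          rw [Finset.mem_erase]
          refine ⟨?_, ?_⟩
          · rintro rfl; exact hwx (huniq w hwA hv.symm)
          · rcases hs.neighbor_mem hwm hv with h1 | h1
            · rw [hw, Finset.mem_singleton] at h1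
              exact absurd h1.symm hv.ne
            · exact h1
        · rw [Finset.card_erase_of_mem hzm, hm]; exact cr.deg w
      have hwx' : G.Adj w x := by
        rw [← SimpleGraph.mem_neighborFinset, heq, Finset.mem_erase]
        exact ⟨hzx.ne.symm, hxm⟩
      have := cr.sparse z w x hz hwz.symm hzx hwx'
      rw [heq, Finset.card_erase_of_mem hzm, hm] at this
      omega
  have right : ∀ {C D : Finset V}, IsNSep G C R D → (B ∩ C).card = 0 ∨
      5 ≤ (B ∩ R).card + (S ∩ R).card + (S ∩ C).card := by
    intro C D k
    by_contra! hlt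
    have := cr.five_le hz (h.symm.toIsSep.corner k.toIsSep) (mem_cornerMid.2 (by tauto))
      (Finset.card_pos.1 (by omega))
      ((Finset.card_pos.1 (by have := h.two_le_left; omega) : A.Nonempty).mono
        Finset.subset_union_left)
    rw [h.symm.toIsSep.card_corner k.toIsSep] at this
    omega
  obtain ⟨⟨e1, e2, e3⟩, e4, e5, e6⟩ := h.cells k
  have l1 := left k
  have l2 := left k.symm
  have r1 := right k
  have r2 := right k.symm
  have ha : 1 ≤ (A ∩ R).card := Finset.card_pos.2 ⟨x, Finset.mem_inter.2 ⟨hxA, hxR⟩⟩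
  have hb : 1 ≤ (S ∩ R).card := Finset.card_pos.2 ⟨z, Finset.mem_inter.2 ⟨hzS, hzR⟩⟩
  have := h.two_le_left
  have := h.two_le_right
  have := k.two_le_left
  have := k.two_le_right
  clear left right
  have hA : A.card = (A ∩ R).card ∧ A.card = 2 ∧ (S ∩ R).card = 1 ∧ (S ∩ C).card = 2 ∧
      (S ∩ D).card = 2 ∧ (B ∩ R).card = 2 := by
    rcases l1 with l1 | l1 <;> rcases l2 with l2 | l2 <;> rcases r1 with r1 | r1 <;>
      rcases r2 with r2 | r2 <;> omega
  refine ⟨hA.2.1, ?_, hA.2.2⟩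
  rw [← Finset.eq_of_subset_of_card_le (Finset.inter_subset_left : A ∩ R ⊆ A) hA.1.le]
  exact Finset.inter_subset_right

/-- The structure of a side containing exactly one neighbour `x` of `z`. -/
lemma side (cr : Critical G) (hz : (G.neighborFinset z).card = 4) {x x' : V}
    (h : IsNSep G A S B) (hzS : z ∈ S) (hxA : x ∈ A) (hzx : G.Adj z x)
    (huniq : ∀ a ∈ A, G.Adj z a → a = x) (hx'S : x' ∈ S) (hzx' : G.Adj z x') :
    ∃ v, v ≠ x ∧ A = {x, v} ∧ ¬ G.Adj z v ∧ G.neighborFinset v = insert x (S.erase z) := by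
  obtain ⟨C, R, D, k, hzR, hxR⟩ := cr.star hz hzx
  obtain ⟨v, hvx, rfl⟩ := eq_pair_of_card_two (cr.cross hz h hzS hxA hzx huniq k hzR hxR).1 hxA
  have hzv : ¬ G.Adj z v := fun hh => hvx (huniq v (by simp) hh)
  have hvz : z ≠ v := by rintro rfl; exact h.left_mid z (by simp) hzS
  have hxS : x ∉ S := h.left_mid x (by simp)
  have hsub : G.neighborFinset v ⊆ insert x (S.erase z) := by
    intro u hu
    rw [SimpleGraph.mem_neighborFinset] at hu
    rw [Finset.mem_insert, Finset.mem_erase]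
    rcases h.pair_swap.toIsSep.pair_neighbor hu with h1 | h1
    · exact Or.inl h1
    · exact Or.inr ⟨by rintro rfl; exact hzv hu.symm, h1⟩
  have hE : (S.erase z).card = 4 := by rw [Finset.card_erase_of_mem hzS, h.card_mid]
  -- If `v` had degree four, it would be adjacent to `x` or to all of `S \ {z}`, which contains
  -- `x'`; either is a common neighbour with `z`.
  have hdeg : 5 ≤ (G.neighborFinset v).card := by
    by_contra hlt
    have hxv : ¬ G.Adj v x := fun hh => hlt (cr.sparse z v x hz hvz hzx hh)
    have hsub' : G.neighborFinset v ⊆ S.erase z := by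
      intro u hu
      rcases Finset.mem_insert.1 (hsub hu) with rfl | h1
      · rw [SimpleGraph.mem_neighborFinset] at hu
        exact absurd hu hxv
      · exact h1
    have heq := Finset.eq_of_subset_of_card_le hsub' (by rw [hE]; exact cr.deg v)
    have : G.Adj v x' := by
      rw [← SimpleGraph.mem_neighborFinset, heq, Finset.mem_erase]
      exact ⟨hzx'.ne.symm, hx'S⟩
    exact hlt (cr.sparse z v x' hz hvz hzx' this)
  refine ⟨v, hvx, rfl, hzv, Finset.eq_of_subset_of_card_le hsub ?_⟩
  exact (Finset.card_insert_le _ _).trans (by omega)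

end Critical

/-- A pair `{x, v}` cut off by a separation through the degree four vertex `z`, where `x` is a
neighbour of `z` and `v` is not. -/
structure IsZPair (G : SimpleGraph V) [DecidableRel G.Adj] (z x v : V) (S B : Finset V) :
    Prop where
  sep : IsNSep G {x, v} S B
  mem : z ∈ S
  adj : G.Adj z x
  not_adj : ¬ G.Adj z v
  nbr : G.neighborFinset v = insert x (S.erase z)

lemma IsZPair.adj_iff {z x v : V} {S B : Finset V} (h : IsZPair G z x v S B) (u : V) :
    G.Adj v u ↔ u = x ∨ (u ≠ z ∧ u ∈ S) := by
  rw [← SimpleGraph.mem_neighborFinset, h.nbr, Finset.mem_insert, Finset.mem_erase]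

lemma IsZPair.unique {z x v : V} {S B : Finset V} (h : IsZPair G z x v S B) :
    ∀ a ∈ ({x, v} : Finset V), G.Adj z a → a = x := by
  intro a ha hza
  simp only [Finset.mem_insert, Finset.mem_singleton] at ha
  rcases ha with rfl | rfl
  · rfl
  · exact absurd hza h.not_adj

namespace Critical

variable {z : V} {A S B C R D : Finset V}

/-- One of the four neighbours of `z` is in the middle and each side has at least one, so some side
has exactly one. -/
lemma exists_zpair (cr : Critical G) (hz : (G.neighborFinset z).card = 4) {x' : V}
    (hzx' : G.Adj z x') : ∃ x v, ∃ S B : Finset V, IsZPair G z x v S B ∧ x' ∈ S := by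
  obtain ⟨A, S, B, h, hzS, hxS⟩ := cr.star hz hzx'
  have key : ∀ {A B : Finset V}, IsNSep G A S B → (G.neighborFinset z ∩ A).card = 1 →
      ∃ x v, ∃ S B : Finset V, IsZPair G z x v S B ∧ x' ∈ S := by
    intro A B h h1
    obtain ⟨x, hx⟩ := Finset.card_eq_one.1 h1
    have hx' : ∀ a, a ∈ A ∧ G.Adj z a ↔ a = x := by
      intro a
      rw [← Finset.mem_singleton, ← hx, Finset.mem_inter, SimpleGraph.mem_neighborFinset]
      tauto
    obtain ⟨hxA, hzx⟩ := (hx' x).2 rfl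
    obtain ⟨v, hvx, rfl, hzv, hN⟩ := cr.side hz h hzS hxA hzx
      (fun a ha hza => (hx' a).1 ⟨ha, hza⟩) hxS hzx'
    exact ⟨x, v, S, B, ⟨h, hzS, hzx, hzv, hN⟩, hxS⟩
  have hsum := h.toIsSep.card_inter (G.neighborFinset z)
  have h1 : 1 ≤ (G.neighborFinset z ∩ S).card :=
    Finset.card_pos.2 ⟨x', by simp [hxS, hzx']⟩
  obtain ⟨a, ha, hza⟩ := h.exists_adj_left cr.quasi hzS
  obtain ⟨b, hb, hzb⟩ := h.exists_adj_right cr.quasi hzS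
  have h2 : 1 ≤ (G.neighborFinset z ∩ A).card := Finset.card_pos.2 ⟨a, by simp [ha, hza]⟩
  have h3 : 1 ≤ (G.neighborFinset z ∩ B).card := Finset.card_pos.2 ⟨b, by simp [hb, hzb]⟩
  by_cases hA : (G.neighborFinset z ∩ A).card = 1
  · exact key h hA
  · exact key h.symm (by omega)

end Critical

/-! ### Linked pairs at a vertex of degree four. -/

/-- Two pairs at the vertex `z`, each contained in the boundary of the other. -/
structure LinkedPairs (G : SimpleGraph V) [DecidableRel G.Adj] (z x₂ v : V) (S₁ B₁ : Finset V)
    (x₁ v' : V) (S₂ B₂ : Finset V) : Prop where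
  deg : (G.neighborFinset z).card = 4
  fst : IsZPair G z x₂ v S₁ B₁
  snd : IsZPair G z x₁ v' S₂ B₂
  x₁_mem : x₁ ∈ S₁
  v'_mem : v' ∈ S₁
  x₂_mem : x₂ ∈ S₂
  v_mem : v ∈ S₂
  inter : ∀ u, u ∈ S₁ → u ∈ S₂ → u = z
  card_fst : (S₁ ∩ B₂).card = 2
  card_snd : (S₂ ∩ B₁).card = 2

namespace Critical

variable {z x₂ v x₁ v' : V} {S₁ B₁ S₂ B₂ C R D : Finset V}

/-- The second separation is chosen with `x₂` in its middle, so `cross` applies and gives all the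
incidences. -/
lemma exists_linkedPairs (cr : Critical G) (hz : (G.neighborFinset z).card = 4) :
    ∃ x₂ v, ∃ S₁ B₁ : Finset V, ∃ x₁ v', ∃ S₂ B₂ : Finset V,
      LinkedPairs G z x₂ v S₁ B₁ x₁ v' S₂ B₂ := by
  obtain ⟨x₀, hx₀⟩ := Finset.card_pos.1 (by omega : 0 < (G.neighborFinset z).card)
  rw [SimpleGraph.mem_neighborFinset] at hx₀
  obtain ⟨x₂, v, S₁, B₁, h₁, -⟩ := cr.exists_zpair hz hx₀
  obtain ⟨x₁, v', S₂, B₂, h₂, hx₂⟩ := cr.exists_zpair hz h₁.adj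
  obtain ⟨-, hsub, c1, c2, c3, c4⟩ := cr.cross hz h₁.sep h₁.mem (by simp) h₁.adj h₁.unique h₂.sep
    h₂.mem hx₂
  have hS := eq_singleton_of_card_one c1 (Finset.mem_inter.2 ⟨h₁.mem, h₂.mem⟩)
  have hA : ({x₁, v'} : Finset V) ⊆ S₁ := by
    have : S₁ ∩ {x₁, v'} = {x₁, v'} := Finset.eq_of_subset_of_card_le Finset.inter_subset_right
      (by rw [c2]; exact Finset.card_le_two)
    rw [← this]; exact Finset.inter_subset_left
  refine ⟨x₂, v, S₁, B₁, x₁, v', S₂, B₂, hz, h₁, h₂, hA (by simp), hA (by simp), hx₂,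
    hsub (by simp), fun u h3 h4 => ?_, c3, ?_⟩
  · have : u ∈ S₁ ∩ S₂ := Finset.mem_inter.2 ⟨h3, h4⟩
    rwa [hS, Finset.mem_singleton] at this
  · rw [Finset.inter_comm]; exact c4

end Critical

namespace LinkedPairs

variable {z x₂ v x₁ v' : V} {S₁ B₁ S₂ B₂ C R D : Finset V}

lemma v'_adj_x₂ (h : LinkedPairs G z x₂ v S₁ B₁ x₁ v' S₂ B₂) : G.Adj v' x₂ :=
  (h.snd.adj_iff _).2 (Or.inr ⟨h.fst.adj.ne.symm, h.x₂_mem⟩)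

lemma v_adj_x₁ (h : LinkedPairs G z x₂ v S₁ B₁ x₁ v' S₂ B₂) : G.Adj v x₁ :=
  (h.fst.adj_iff _).2 (Or.inr ⟨h.snd.adj.ne.symm, h.x₁_mem⟩)

/-- If `v'` lies on the left, then `z` is the only neighbour of `x₁` on the right. -/
lemma right_nbr (h : LinkedPairs G z x₂ v S₁ B₁ x₁ v' S₂ B₂) (k : IsNSep G C R D)
    (hv' : v' ∈ C) : ∀ a ∈ D, G.Adj x₁ a → a = z := by
  intro a ha hxa
  by_contra hne
  rcases h.snd.sep.toIsSep.pair_neighbor hxa with rfl | h1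
  · exact k.left_right _ hv' ha
  · exact k.not_adj v' hv' a ha ((h.snd.adj_iff _).2 (Or.inr ⟨hne, h1⟩))

/-- The vertex `z` is the only neighbour of `x₁` in `D`, which forces `D = {z, d}`. This determines
the neighbourhood of `z` and makes `B₁` and `B₂` two-vertex sides, after which `C` has no room for a
vertex besides `v'`. -/
lemma false_of_left (h : LinkedPairs G z x₂ v S₁ B₁ x₁ v' S₂ B₂) (cr : Critical G)
    (k : IsNSep G C R D) (hx₁ : x₁ ∈ R) (hv : v ∈ R) (hv' : v' ∈ C) : False := by
  have hz := h.deg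
  have hnb := h.right_nbr k hv'
  have hzD : z ∈ D := by
    obtain ⟨a, ha, hxa⟩ := k.exists_adj_right cr.quasi hx₁
    rwa [← hnb a ha hxa]
  have hx₂ : x₂ ∈ R := by
    rcases k.toIsSep.neighbor_mem hv' h.v'_adj_x₂ with h1 | h1
    · exact absurd h.fst.adj.symm (k.not_adj _ h1 _ hzD)
    · exact h1
  have hzC : ∀ a ∈ C, ¬ G.Adj z a := fun a ha hza => k.not_adj a ha z hzD hza.symm
  have hzx₁ := h.snd.adj
  -- Otherwise exchange `x₁` for `z`. Then `x₁` is the only neighbour of `z` on the left, and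
  -- `cross` bounds `C` together with `x₁` by two vertices.
  have hD2 : D.card = 2 := by
    by_contra hD
    have hs := (k.symm.toIsSep.swap hx₁ hzD hnb).symm
    have hn : IsNSep G (insert x₁ C) (insert z (R.erase x₁)) (D.erase z) := by
      refine ⟨hs, ?_, ?_, ?_⟩
      · rw [Finset.card_insert_of_notMem, Finset.card_erase_of_mem hx₁, k.card_mid]
        exact fun hh => k.mid_right _ (Finset.mem_of_mem_erase hh) hzD
      · exact k.two_le_left.trans (Finset.card_le_card (Finset.subset_insert _ _))
      · rw [Finset.card_erase_of_mem hzD]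
        have := k.two_le_right
        omega
    obtain ⟨C', R', D', k', hzR, hxR⟩ := cr.star hz hzx₁
    have := (cr.cross hz hn (by simp) (by simp) hzx₁ (fun a ha hza => by
      rcases Finset.mem_insert.1 ha with h1 | h1
      · exact h1
      · exact absurd hza (hzC a h1)) k' hzR hxR).1
    rw [Finset.card_insert_of_notMem (fun hh => k.left_mid _ hh hx₁)] at this
    have := k.two_le_left
    omega
  obtain ⟨d, hdz, rfl⟩ := eq_pair_of_card_two hD2 hzD
  have hdR : d ∉ R := fun hh => k.mid_right _ hh (by simp)
  have hdC : d ∉ C := fun hh => k.left_right _ hh (by simp)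
  have hx₁d : ¬ G.Adj x₁ d := fun hh => hdz (hnb d (by simp) hh)
  have hNd : ∀ u, G.Adj d u → u = z ∨ (u ≠ x₁ ∧ u ∈ R) := by
    intro u hu
    rcases k.symm.pair_swap.toIsSep.pair_neighbor hu with h1 | h1
    · exact Or.inl h1
    · exact Or.inr ⟨by rintro rfl; exact hx₁d hu.symm, h1⟩
  have hE : (R.erase x₁).card = 4 := by rw [Finset.card_erase_of_mem hx₁, k.card_mid]
  have hx₂₁ : x₂ ≠ x₁ := by
    rintro rfl; exact h.snd.sep.left_mid x₂ (by simp) h.x₂_mem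
  have hzd : G.Adj z d := by
    by_contra hzd
    have heq : G.neighborFinset d = R.erase x₁ := by
      apply Finset.eq_of_subset_of_card_le
      · intro u hu
        rw [SimpleGraph.mem_neighborFinset] at hu
        rcases hNd u hu with rfl | h1
        · exact absurd hu.symm hzd
        · exact Finset.mem_erase.2 h1
      · rw [hE]; exact cr.deg d
    have hdx₂ : G.Adj d x₂ := by
      rw [← SimpleGraph.mem_neighborFinset, heq]
      exact Finset.mem_erase.2 ⟨hx₂₁, hx₂⟩
    have := cr.sparse z d x₂ hz hdz.symm h.fst.adj hdx₂
    rw [heq, hE] at this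
    omega
  have hNd' : G.neighborFinset d = insert z (R.erase x₁) := by
    apply Finset.eq_of_subset_of_card_le
    · intro u hu
      rw [SimpleGraph.mem_neighborFinset] at hu
      rw [Finset.mem_insert, Finset.mem_erase]
      exact hNd u hu
    · refine (Finset.card_insert_le _ _).trans ?_
      rw [hE]; exact cr.sparse_adj z d hz hzd
  have hvx₁ : v ≠ x₁ := h.v_adj_x₁.ne
  have hdv : G.Adj d v := by
    rw [← SimpleGraph.mem_neighborFinset, hNd', Finset.mem_insert, Finset.mem_erase]
    exact Or.inr ⟨hvx₁, hv⟩
  have hdx₂ : d ≠ x₂ := by rintro rfl; exact hdR hx₂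
  have hdx₁ : d ≠ x₁ := by rintro rfl; exact hdR hx₁
  have hdS₁ : d ∈ S₁ := by
    rcases (h.fst.adj_iff d).1 hdv.symm with h1 | h1
    · exact absurd h1 hdx₂
    · exact h1.2
  have hdS₂ : d ∉ S₂ := fun hh => hdz (h.inter d hdS₁ hh)
  obtain ⟨x₄, hx₄B, hzx₄⟩ := h.fst.sep.exists_adj_right cr.quasi h.fst.mem
  have hx₂B : x₂ ∉ B₁ := h.fst.sep.left_right x₂ (by simp)
  have hS₁B : ∀ u ∈ S₁, u ∉ B₁ := h.fst.sep.mid_right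
  have hNz : ∀ u, G.Adj z u → u = x₁ ∨ u = x₂ ∨ u = d ∨ u = x₄ := by
    have hsub : ({x₁, x₂, d, x₄} : Finset V) ⊆ G.neighborFinset z := by
      intro u
      simp only [Finset.mem_insert, Finset.mem_singleton, SimpleGraph.mem_neighborFinset]
      rintro (rfl | rfl | rfl | rfl)
      exacts [hzx₁, h.fst.adj, hzd, hzx₄]
    have n1 : x₁ ≠ x₄ := by rintro rfl; exact hS₁B _ h.x₁_mem hx₄B
    have n2 : x₂ ≠ x₄ := by rintro rfl; exact hx₂B hx₄B
    have n3 : d ≠ x₄ := by rintro rfl; exact hS₁B _ hdS₁ hx₄B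
    have heq := Finset.eq_of_subset_of_card_le hsub (by
      rw [hz, Finset.card_insert_of_notMem, Finset.card_insert_of_notMem, Finset.card_pair n3] <;>
        simp [hx₂₁.symm, hdx₁.symm, hdx₂.symm, n1, n2])
    intro u hu
    rw [← SimpleGraph.mem_neighborFinset, ← heq] at hu
    simpa using hu
  obtain ⟨e, hex₄, hB₁, -, hNe⟩ := cr.side hz h.fst.sep.symm h.fst.mem hx₄B hzx₄ (by
    intro a ha hza
    rcases hNz a hza with rfl | rfl | rfl | rfl
    · exact absurd ha (hS₁B _ h.x₁_mem)
    · exact absurd ha hx₂B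
    · exact absurd ha (hS₁B _ hdS₁)
    · rfl) h.x₁_mem hzx₁
  have hB₁S₂ : B₁ ⊆ S₂ := by
    have : S₂ ∩ B₁ = B₁ := Finset.eq_of_subset_of_card_le Finset.inter_subset_right (by
      rw [h.card_snd, hB₁]; exact Finset.card_le_two)
    rw [← this]; exact Finset.inter_subset_left
  have hed : G.Adj e d := by
    rw [← SimpleGraph.mem_neighborFinset, hNe, Finset.mem_insert, Finset.mem_erase]
    exact Or.inr ⟨hdz, hdS₁⟩
  have hB₂ : ∀ a ∈ B₂, G.Adj z a → a = d := by
    intro a ha hza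
    rcases hNz a hza with rfl | rfl | rfl | rfl
    · exact absurd ha (h.snd.sep.left_right _ (by simp))
    · exact absurd ha (h.snd.sep.mid_right _ h.x₂_mem)
    · rfl
    · exact absurd ha (h.snd.sep.mid_right _ (hB₁S₂ hx₄B))
  obtain ⟨a, haB, hza⟩ := h.snd.sep.exists_adj_right cr.quasi h.snd.mem
  have := hB₂ a haB hza
  subst this
  obtain ⟨b, hba, hB₂eq, -, hNb⟩ := cr.side hz h.snd.sep.symm h.snd.mem haB hza hB₂ h.x₂_mem h.fst.adj
  have hab : G.Adj a b := by
    rw [G.adj_comm, ← SimpleGraph.mem_neighborFinset, hNb]; simp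
  have hbC : b ∉ C := fun hh => k.not_adj b hh a (by simp) hab.symm
  obtain ⟨c, hc⟩ := Finset.card_pos.1 (by
    rw [Finset.card_erase_of_mem hv']
    have := k.two_le_left
    omega : 0 < (C.erase v').card)
  rw [Finset.mem_erase] at hc
  obtain ⟨hcv', hcC⟩ := hc
  have hcR : c ∉ R := k.left_mid _ hcC
  have hcD := k.left_right _ hcC
  simp only [Finset.mem_insert, Finset.mem_singleton, not_or] at hcD
  have hcS₂ : c ∈ S₂ := by
    rcases h.snd.sep.cover c with h1 | h1 | h1
    · simp only [Finset.mem_insert, Finset.mem_singleton] at h1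
      rcases h1 with rfl | rfl
      · exact absurd hx₁ hcR
      · exact absurd rfl hcv'
    · exact h1
    · rw [hB₂eq] at h1
      simp only [Finset.mem_insert, Finset.mem_singleton] at h1
      rcases h1 with rfl | rfl
      · exact absurd rfl hcD.2
      · exact absurd hcC hbC
  rcases h.fst.sep.cover c with h1 | h1 | h1
  · simp only [Finset.mem_insert, Finset.mem_singleton] at h1
    rcases h1 with rfl | rfl
    · exact hcR hx₂
    · exact hcR hv
  · exact hcD.1 (h.inter c h1 hcS₂)
  · rw [hB₁] at h1
    simp only [Finset.mem_insert, Finset.mem_singleton] at h1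
    rcases h1 with rfl | rfl
    · exact hzC _ hcC hzx₄
    · exact k.not_adj _ hcC a (by simp) hed

/-- One side contains a single vertex of `S₁`. Its corner with `B₁` has a middle of order four
containing `x₁`, hence consists of a vertex of degree four at distance at most two from `z`. -/
lemma false_of_mid (h : LinkedPairs G z x₂ v S₁ B₁ x₁ v' S₂ B₂) (cr : Critical G)
    (k : IsNSep G C R D) (hx₁ : x₁ ∈ R) (hv : v ∈ R) (hv' : v' ∈ R) (hx₂ : x₂ ∈ R) : False := by
  have hxv : x₁ ≠ v' := h.snd.sep.pair_ne
  have hSR : 2 ≤ (S₁ ∩ R).card := by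
    rw [← Finset.card_pair hxv]
    apply Finset.card_le_card
    intro u
    simp only [Finset.mem_insert, Finset.mem_singleton, Finset.mem_inter]
    rintro (rfl | rfl)
    exacts [⟨h.x₁_mem, hx₁⟩, ⟨h.v'_mem, hv'⟩]
  have nb : ∀ {C D : Finset V}, IsNSep G C R D → 1 ≤ (S₁ ∩ C).card := by
    intro C D k
    obtain ⟨a, ha, hva⟩ := k.exists_adj_left cr.quasi hv
    refine Finset.card_pos.2 ⟨a, Finset.mem_inter.2 ⟨?_, ha⟩⟩
    rcases h.fst.sep.pair_swap.toIsSep.pair_neighbor hva with rfl | h1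
    · exact absurd hx₂ (k.left_mid _ ha)
    · exact h1
  have key : ∀ {C D : Finset V}, IsNSep G C R D → (S₁ ∩ C).card = 1 → False := by
    intro C D k h1
    obtain ⟨⟨e1, e2, e3⟩, e4, e5, e6⟩ := h.fst.sep.cells k
    have hAR : ({x₂, v} : Finset V) ∩ R = {x₂, v} := by
      rw [Finset.inter_eq_left]; intro u
      simp only [Finset.mem_insert, Finset.mem_singleton]
      rintro (rfl | rfl) <;> assumption
    have hA2 : ({x₂, v} : Finset V).card = 2 := Finset.card_pair h.fst.sep.pair_ne
    rw [hAR] at e1 e5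
    have hc := h.fst.sep.symm.toIsSep.card_corner k.toIsSep
    have := k.two_le_left
    obtain ⟨w, hw, hNw⟩ := cr.eq_singleton (h.fst.sep.symm.toIsSep.corner k.toIsSep) (by omega)
      (Finset.card_pos.1 (by omega))
      (k.two_le_right.trans (Finset.card_le_card Finset.subset_union_right))
    have hwB : w ∈ B₁ ∩ C := by rw [hw]; simp
    have hwz : z ≠ w := by
      rintro rfl; exact h.fst.sep.mid_right _ h.fst.mem (Finset.mem_inter.1 hwB).1
    have := cr.sparse z w x₁ h.deg hwz h.snd.adj (by
      rw [← SimpleGraph.mem_neighborFinset, hNw, mem_cornerMid]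
      exact Or.inr (Or.inl ⟨h.x₁_mem, hx₁⟩))
    rw [hNw] at this
    omega
  have hsum := k.toIsSep.card_inter S₁
  rw [h.fst.sep.card_mid] at hsum
  have n1 := nb k
  have n2 := nb k.symm
  by_cases hc : (S₁ ∩ C).card = 1
  · exact key k hc
  · exact key k.symm (by omega)

end LinkedPairs

namespace LinkedPairs

variable {z x₂ v x₁ v' : V} {S₁ B₁ S₂ B₂ C R D : Finset V}

/-- The exceptional configuration in which the right side consists of a vertex `y` of degree four
and one further vertex. -/
lemma false_of_right_pair (h : LinkedPairs G z x₂ v S₁ B₁ x₁ v' S₂ B₂) (cr : Critical G)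
    {y e : V} (k : IsNSep G C R {y, e}) (hx₁ : x₁ ∈ R) (hv : v ∈ R) (hv' : v' ∈ R) (hx₂ : x₂ ∈ C)
    (hy : (G.neighborFinset y).card = 4) (hyN : ∀ u, G.Adj y u ↔ u = e ∨ (u ∈ R ∧ u ≠ x₁ ∧ u ≠ v'))
    (hyS₁ : y ∈ S₁) (hx₂N : G.neighborFinset x₂ = insert v (S₁.erase y)) (heS₂ : e ∈ S₂) :
    False := by
  have hvx₁ : v ≠ x₁ := h.v_adj_x₁.ne
  have hvv' : v ≠ v' := by
    rintro rfl; exact h.fst.sep.left_mid v (by simp) h.v'_mem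
  have hyv : G.Adj y v := (hyN v).2 (Or.inr ⟨hv, hvx₁, hvv'⟩)
  have hye : G.Adj y e := (hyN e).2 (Or.inl rfl)
  have hyR : y ∉ R := k.symm.left_mid y (by simp)
  have heR : e ∉ R := k.symm.left_mid e (by simp)
  have hyC : y ∉ C := k.symm.left_right y (by simp)
  have heC : e ∉ C := k.symm.left_right e (by simp)
  have hCe : ∀ a ∈ C, ¬ G.Adj a e := fun a ha => k.not_adj a ha e (by simp)
  have hCy : ∀ a ∈ C, ¬ G.Adj y a := fun a ha hya => k.not_adj a ha y (by simp) hya.symm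
  have hyz : y ≠ z := by
    rintro rfl; exact hCy x₂ hx₂ h.fst.adj
  have hS₂v : ∀ u ∈ S₂, u ≠ z → u ≠ x₂ → ¬ G.Adj v u := by
    intro u hu huz hux hvu
    rcases (h.fst.adj_iff u).1 hvu with h1 | h1
    · exact hux h1
    · exact huz (h.inter u h1.2 hu)
  have hez : e ≠ z := by
    rintro rfl; exact hCe x₂ hx₂ h.fst.adj.symm
  have hve : ¬ G.Adj v e := hS₂v e heS₂ hez (by rintro rfl; exact heC hx₂)
  have hNe : G.neighborFinset e = insert y (R.erase v) := by
    apply Finset.eq_of_subset_of_card_le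
    · intro u hu
      rw [SimpleGraph.mem_neighborFinset] at hu
      rw [Finset.mem_insert, Finset.mem_erase]
      rcases k.symm.pair_swap.toIsSep.pair_neighbor hu with h1 | h1
      · exact Or.inl h1
      · exact Or.inr ⟨by rintro rfl; exact hve hu.symm, h1⟩
    · refine (Finset.card_insert_le _ _).trans ?_
      rw [Finset.card_erase_of_mem hv, k.card_mid]; exact cr.sparse_adj y e hy hye
  obtain ⟨x, w, S, B, hp, hvS⟩ := cr.exists_zpair hy hyv
  have hyx := hp.adj
  have hxS : x ∉ S := hp.sep.left_mid x (by simp)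
  have hxv : x ≠ v := by rintro rfl; exact hxS hvS
  have hwv : G.Adj w v := (hp.adj_iff v).2 (Or.inr ⟨hyv.ne.symm, hvS⟩)
  have hwx : G.Adj w x := (hp.adj_iff x).2 (Or.inl rfl)
  have hzx : ¬ G.Adj z x := fun hh => by
    have := cr.sparse y z x hy hyz hyx hh
    have := h.deg
    omega
  have hyz' : ¬ G.Adj y z := fun hh => by
    have := cr.sparse_adj y z hy hh
    have := h.deg
    omega
  have hxz : x ≠ z := by rintro rfl; exact hyz' hyx
  have hxx₂ : x ≠ x₂ := by rintro rfl; exact hCy x hx₂ hyx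
  -- As a neighbour of `y`, the vertex `x` has degree at least five and can miss at most one vertex
  -- of `S`.
  have two : ∀ u₁ u₂, u₁ ∈ S → u₂ ∈ S → u₁ ≠ u₂ → ¬ G.Adj x u₁ → ¬ G.Adj x u₂ → False := by
    intro u₁ u₂ h1 h2 hne n1 n2
    have hsub : G.neighborFinset x ⊆ insert w ((S.erase u₁).erase u₂) := by
      intro u hu
      rw [SimpleGraph.mem_neighborFinset] at hu
      rw [Finset.mem_insert, Finset.mem_erase, Finset.mem_erase]
      rcases hp.sep.toIsSep.pair_neighbor hu with h3 | h3
      · exact Or.inl h3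
      · refine Or.inr ⟨?_, ?_, h3⟩
        · rintro rfl; exact n2 hu
        · rintro rfl; exact n1 hu
    have h5 := cr.sparse_adj y x hy hyx
    have h6 := (Finset.card_le_card hsub).trans (Finset.card_insert_le _ _)
    rw [Finset.card_erase_of_mem (Finset.mem_erase.2 ⟨hne.symm, h2⟩), Finset.card_erase_of_mem h1,
      hp.sep.card_mid] at h6
    omega
  rcases k.cover w with hw | hw | hw
  · rcases (hyN x).1 hyx with rfl | ⟨hxR, -, -⟩
    · exact hCe w hw hwx
    · have hex : G.Adj x e := by
        rw [G.adj_comm, ← SimpleGraph.mem_neighborFinset, hNe, Finset.mem_insert, Finset.mem_erase]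
        exact Or.inr ⟨hxv, hxR⟩
      rcases hp.sep.toIsSep.pair_neighbor hex with rfl | h1
      · exact heC hw
      · exact hCe w hw ((hp.adj_iff e).2 (Or.inr ⟨hye.ne.symm, h1⟩))
  · have hw' : w = x₁ ∨ w = v' := by
      by_contra! hne
      exact hp.not_adj ((hyN w).2 (Or.inr ⟨hw, hne⟩))
    have hxx₁ : x ≠ x₁ := by
      rintro rfl
      rcases (hyN x).1 hyx with h1 | h1
      · exact heR (h1 ▸ hx₁)
      · exact h1.2.1 rfl
    have hxv' : x ≠ v' := by
      rintro rfl
      rcases (hyN x).1 hyx with h1 | h1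
      · exact heR (h1 ▸ hv')
      · exact h1.2.2 rfl
    have hxS₂ : x ∈ S₂ := by
      rcases hw' with rfl | rfl
      · exact (h.snd.sep.toIsSep.pair_neighbor hwx).resolve_left hxv'
      · exact (h.snd.sep.pair_swap.toIsSep.pair_neighbor hwx).resolve_left hxx₁
    have hnv : ¬ G.Adj x v := fun hh => hS₂v x hxS₂ hxz hxx₂ hh.symm
    rcases hw' with rfl | rfl
    · have hzS : z ∈ S := (((hp.adj_iff z).1 h.snd.adj.symm).resolve_left hxz.symm).2
      exact two v z hvS hzS (by rintro rfl; exact hyz' hyv) hnv (fun hh => hzx hh.symm)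
    · have hxS : x₂ ∈ S := (((hp.adj_iff x₂).1 h.v'_adj_x₂).resolve_left hxx₂.symm).2
      refine two v x₂ hvS hxS h.fst.sep.pair_ne.symm hnv (fun hh => ?_)
      rw [G.adj_comm, ← SimpleGraph.mem_neighborFinset, hx₂N, Finset.mem_insert,
        Finset.mem_erase] at hh
      rcases hh with h1 | h1
      · exact hxv h1
      · exact hxz (h.inter x h1.2 hxS₂)
  · simp only [Finset.mem_insert, Finset.mem_singleton] at hw
    rcases hw with rfl | rfl
    · exact hp.sep.left_mid w (by simp) hp.mem
    · exact hve hwv.symm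

set_option maxHeartbeats 400000 in
-- The split is on `|S₂ ∩ D|`. If it is one, then `D` is the exceptional pair of
-- `false_of_right_pair`. Otherwise `S₂ ∩ C = {z, x₂}`, and either `v'` can be exchanged for `x₂`,
-- leading back to `false_of_left`, or `C = {z, x₂}`.
lemma false_of_mid_left (h : LinkedPairs G z x₂ v S₁ B₁ x₁ v' S₂ B₂) (cr : Critical G)
    (k : IsNSep G C R D) (hx₁ : x₁ ∈ R) (hv : v ∈ R) (hv' : v' ∈ R) (hx₂ : x₂ ∈ C) : False := by
  have hz := h.deg
  have hzx₂ := h.fst.adj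
  have hzD : z ∉ D := fun hh => k.not_adj x₂ hx₂ z hh hzx₂.symm
  have hx₂D : ∀ a ∈ D, ¬ G.Adj x₂ a := fun a ha => k.not_adj x₂ hx₂ a ha
  have hx₂R : x₂ ∉ R := k.left_mid _ hx₂
  have hvz : v ≠ z := by rintro rfl; exact h.fst.sep.left_mid v (by simp) h.fst.mem
  obtain ⟨y, hyD, hvy⟩ := k.exists_adj_right cr.quasi hv
  have hyR : y ∉ R := fun hh => k.mid_right _ hh hyD
  have hyz : y ≠ z := by rintro rfl; exact hzD hyD
  have hyS₁ : y ∈ S₁ := by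
    rcases h.fst.sep.pair_swap.toIsSep.pair_neighbor hvy with rfl | h1
    · exact absurd hyD (k.left_right _ hx₂)
    · exact h1
  have hx₂y := hx₂D y hyD
  have hdx₂ := cr.sparse_adj z x₂ hz hzx₂
  obtain ⟨-, hx₂all⟩ := h.fst.sep.pair_adj hdx₂ hyS₁ hx₂y
  have hSD : S₁ ∩ D = {y} := by
    ext u
    rw [Finset.mem_inter, Finset.mem_singleton]
    constructor
    · rintro ⟨h1, h2⟩
      by_contra hne
      exact hx₂D u h2 (hx₂all u h1 hne)
    · rintro rfl; exact ⟨hyS₁, hyD⟩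
  have hx₂N : G.neighborFinset x₂ = insert v (S₁.erase y) := by
    apply Finset.eq_of_subset_of_card_le
    · intro u hu
      rw [SimpleGraph.mem_neighborFinset] at hu
      rw [Finset.mem_insert, Finset.mem_erase]
      rcases h.fst.sep.toIsSep.pair_neighbor hu with h1 | h1
      · exact Or.inl h1
      · exact Or.inr ⟨by rintro rfl; exact hx₂y hu, h1⟩
    · refine (Finset.card_insert_le _ _).trans ?_
      rw [Finset.card_erase_of_mem hyS₁, h.fst.sep.card_mid]; exact hdx₂
  have hyB₂ : y ∈ B₂ := by
    rcases h.snd.sep.cover y with h1 | h1 | h1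
    · simp only [Finset.mem_insert, Finset.mem_singleton] at h1
      rcases h1 with rfl | rfl
      · exact absurd hx₁ hyR
      · exact absurd hv' hyR
    · exact absurd (h.inter y hyS₁ h1) hyz
    · exact h1
  have hA₂ : ({x₁, v'} : Finset V) ∩ R = {x₁, v'} := by
    rw [Finset.inter_eq_left]; intro u
    simp only [Finset.mem_insert, Finset.mem_singleton]
    rintro (rfl | rfl) <;> assumption
  have hA₂' : ({x₁, v'} : Finset V).card = 2 := Finset.card_pair h.snd.sep.pair_ne
  obtain ⟨⟨e1, e2, e3⟩, e4, e5, e6⟩ := h.snd.sep.cells k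
  rw [hA₂] at e1 e5
  obtain ⟨a, haD, hva⟩ := k.exists_adj_right cr.quasi hv'
  have haS₂ : a ∈ S₂ := by
    rcases h.snd.sep.pair_swap.toIsSep.pair_neighbor hva with rfl | h1
    · exact absurd haD (k.mid_right _ hx₁)
    · exact h1
  have hSD1 : 1 ≤ (S₂ ∩ D).card := Finset.card_pos.2 ⟨a, Finset.mem_inter.2 ⟨haS₂, haD⟩⟩
  have hv1 : v ∈ S₂ ∩ R := Finset.mem_inter.2 ⟨h.v_mem, hv⟩
  have hSR1 : 1 ≤ (S₂ ∩ R).card := Finset.card_pos.2 ⟨v, hv1⟩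
  have hx₂SC : x₂ ∈ S₂ ∩ C := Finset.mem_inter.2 ⟨h.x₂_mem, hx₂⟩
  have hSC1 : 1 ≤ (S₂ ∩ C).card := Finset.card_pos.2 ⟨x₂, hx₂SC⟩
  by_cases hS1 : (S₂ ∩ D).card = 1
  · have hyBD : y ∈ B₂ ∩ D := Finset.mem_inter.2 ⟨hyB₂, hyD⟩
    obtain ⟨w, hw, hNw⟩ := cr.eq_singleton (h.snd.sep.symm.toIsSep.corner k.symm.toIsSep)
      (by rw [h.snd.sep.symm.toIsSep.card_corner k.symm.toIsSep]; omega) ⟨y, hyBD⟩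
      (k.two_le_left.trans (Finset.card_le_card Finset.subset_union_right))
    have hyw : y = w := by rwa [hw, Finset.mem_singleton] at hyBD
    subst hyw
    have ha := eq_singleton_of_card_one hS1 (Finset.mem_inter.2 ⟨haS₂, haD⟩)
    have hD : D = {y, a} := by
      ext u
      rw [Finset.mem_insert, Finset.mem_singleton]
      constructor
      · intro hu
        rcases h.snd.sep.cover u with h1 | h1 | h1
        · simp only [Finset.mem_insert, Finset.mem_singleton] at h1
          rcases h1 with rfl | rfl
          · exact absurd hu (k.mid_right _ hx₁)
          · exact absurd hu (k.mid_right _ hv')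
        · right
          have : u ∈ S₂ ∩ D := Finset.mem_inter.2 ⟨h1, hu⟩
          rwa [ha, Finset.mem_singleton] at this
        · left
          have : u ∈ B₂ ∩ D := Finset.mem_inter.2 ⟨h1, hu⟩
          rwa [hw, Finset.mem_singleton] at this
      · rintro (rfl | rfl) <;> assumption
    have hyN : ∀ u, G.Adj y u ↔ u = a ∨ (u ∈ R ∧ u ≠ x₁ ∧ u ≠ v') := by
      intro u
      rw [← SimpleGraph.mem_neighborFinset, hNw, mem_cornerMid, ← Finset.mem_inter (s₁ := S₂) (s₂ := D),
        ha, Finset.mem_singleton]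
      have c := h.snd.sep.cover u
      have l1 := h.snd.sep.left_mid u
      have l2 := h.snd.sep.left_right u
      simp only [Finset.mem_insert, Finset.mem_singleton] at c l1 l2
      clear * - c l1 l2
      tauto
    have hycard : (G.neighborFinset y).card = 4 := by
      rw [hNw, h.snd.sep.symm.toIsSep.card_corner k.symm.toIsSep]; omega
    rw [hD] at k
    exact h.false_of_right_pair cr k hx₁ hv hv' hx₂ hycard hyN hyS₁ hx₂N haS₂
  -- With `z` in the middle, `S₂ ∩ C` would be a single vertex and the corner `B₂ ∩ C` a vertex of
  -- degree four adjacent to `z`.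
  · have hzR : z ∉ R := by
      intro hzR
      have hSR2 : 2 ≤ (S₂ ∩ R).card := by
        rw [← Finset.card_pair hvz]
        apply Finset.card_le_card
        intro u
        simp only [Finset.mem_insert, Finset.mem_singleton, Finset.mem_inter]
        rintro (rfl | rfl)
        exacts [⟨h.v_mem, hv⟩, ⟨h.snd.mem, hzR⟩]
      have := k.two_le_left
      obtain ⟨w, hw, hNw⟩ := cr.eq_singleton (h.snd.sep.symm.toIsSep.corner k.toIsSep)
        (by rw [h.snd.sep.symm.toIsSep.card_corner k.toIsSep]; omega)
        (Finset.card_pos.1 (by omega))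
        (k.two_le_right.trans (Finset.card_le_card Finset.subset_union_right))
      have hzw : G.Adj z w := by
        rw [G.adj_comm, ← SimpleGraph.mem_neighborFinset, hNw, mem_cornerMid]
        exact Or.inr (Or.inl ⟨h.snd.mem, hzR⟩)
      have := cr.sparse_adj z w hz hzw
      rw [hNw, h.snd.sep.symm.toIsSep.card_corner k.toIsSep] at this
      omega
    have hzC : z ∈ C := by
      rcases k.cover z with h1 | h1 | h1
      · exact h1
      · exact absurd h1 hzR
      · exact absurd h1 hzD
    have hSC2 : 2 ≤ (S₂ ∩ C).card := by
      rw [← Finset.card_pair hzx₂.ne]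
      apply Finset.card_le_card
      intro u
      simp only [Finset.mem_insert, Finset.mem_singleton, Finset.mem_inter]
      rintro (rfl | rfl)
      exacts [⟨h.snd.mem, hzC⟩, ⟨h.x₂_mem, hx₂⟩]
    have hSC : S₂ ∩ C = {z, x₂} := by
      symm
      apply Finset.eq_of_subset_of_card_le
      · intro u
        simp only [Finset.mem_insert, Finset.mem_singleton, Finset.mem_inter]
        rintro (rfl | rfl)
        exacts [⟨h.snd.mem, hzC⟩, ⟨h.x₂_mem, hx₂⟩]
      · rw [Finset.card_pair hzx₂.ne]; omega
    have hSR := eq_singleton_of_card_one (by omega) hv1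
    have hnb : ∀ b ∈ C, G.Adj v' b → b = x₂ := by
      intro b hb hvb
      rcases (h.snd.adj_iff b).1 hvb with rfl | ⟨h1, h2⟩
      · exact absurd hx₁ (k.left_mid _ hb)
      · have : b ∈ S₂ ∩ C := Finset.mem_inter.2 ⟨h2, hb⟩
        rw [hSC, Finset.mem_insert, Finset.mem_singleton] at this
        exact this.resolve_left h1
    have hx₁v' : x₁ ≠ v' := h.snd.sep.pair_ne
    have hvv' : v ≠ v' := by
      rintro rfl; exact h.fst.sep.left_mid v (by simp) h.v'_mem
    by_cases hC : C.card = 2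
    · obtain ⟨c, hc, hCeq⟩ := eq_pair_of_card_two hC hzC
      have hcx : c = x₂ := by
        rw [hCeq, Finset.mem_insert, Finset.mem_singleton] at hx₂
        exact (hx₂.resolve_left hzx₂.ne.symm).symm
      subst hcx
      have hxS₁ : c ∉ S₁ := h.fst.sep.left_mid c (by simp)
      have hS₁C : S₁ ∩ C = {z} := by
        ext u
        rw [hCeq]
        simp only [Finset.mem_inter, Finset.mem_insert, Finset.mem_singleton]
        constructor
        · rintro ⟨h1, h2 | h2⟩
          · exact h2
          · subst h2; exact absurd h1 hxS₁
        · rintro rfl; exact ⟨h.fst.mem, Or.inl rfl⟩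
      have f1 := k.toIsSep.card_inter S₁
      rw [hS₁C, hSD, h.fst.sep.card_mid, Finset.card_singleton, Finset.card_singleton] at f1
      have f2 := h.fst.sep.toIsSep.card_inter' R
      rw [k.card_mid] at f2
      have f3 : 1 ≤ (({c, v} : Finset V) ∩ R).card :=
        Finset.card_pos.2 ⟨v, Finset.mem_inter.2 ⟨by simp, hv⟩⟩
      have hzB : ∀ a ∈ B₁, G.Adj z a → a ∈ B₁ ∩ R := by
        intro a ha hza
        refine Finset.mem_inter.2 ⟨ha, ?_⟩
        rw [hCeq] at k
        rcases k.toIsSep.pair_neighbor hza with rfl | h1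
        · exact absurd ha (h.fst.sep.left_right _ (by simp))
        · exact h1
      -- Here `|B₁ ∩ R| ≤ 1`, so `x₄` is the only neighbour of `z` in `B₁`. Then `B₁ ⊆ S₂` puts `x₄`
      -- into `S₂ ∩ R = {v}`, but `z` and `v` are not adjacent.
      obtain ⟨x₄, hx₄B, hzx₄⟩ := h.fst.sep.exists_adj_right cr.quasi h.fst.mem
      have hx₄R := hzB x₄ hx₄B hzx₄
      obtain ⟨e, -, hB₁, -⟩ := cr.side hz h.fst.sep.symm h.fst.mem hx₄B hzx₄ (fun a ha hza =>
        Finset.card_le_one.1 (by omega) _ (hzB a ha hza) _ hx₄R) h.x₁_mem h.snd.adj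
      have hx₄S₂ : x₄ ∈ S₂ := by
        have : S₂ ∩ B₁ = B₁ := Finset.eq_of_subset_of_card_le Finset.inter_subset_right (by
          rw [h.card_snd, hB₁]; exact Finset.card_le_two)
        rw [← this] at hx₄B
        exact (Finset.mem_inter.1 hx₄B).1
      have : x₄ ∈ S₂ ∩ R := Finset.mem_inter.2 ⟨hx₄S₂, (Finset.mem_inter.1 hx₄R).2⟩
      rw [hSR, Finset.mem_singleton] at this
      subst this
      exact h.fst.not_adj hzx₄
    · have hs := (k.toIsSep.swap hv' hx₂ hnb).symm
      refine h.false_of_left cr (C := insert v' D) (R := insert x₂ (R.erase v'))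
        (D := C.erase x₂) ⟨hs, ?_, ?_, ?_⟩ ?_ ?_ (by simp)
      · rw [Finset.card_insert_of_notMem, Finset.card_erase_of_mem hv', k.card_mid]
        exact fun hh => hx₂R (Finset.mem_of_mem_erase hh)
      · exact k.two_le_right.trans (Finset.card_le_card (Finset.subset_insert _ _))
      · rw [Finset.card_erase_of_mem hx₂]
        have := k.two_le_left
        omega
      · exact Finset.mem_insert_of_mem (Finset.mem_erase.2 ⟨hx₁v', hx₁⟩)
      · exact Finset.mem_insert_of_mem (Finset.mem_erase.2 ⟨hvv', hv⟩)

lemma false_of_critical (h : LinkedPairs G z x₂ v S₁ B₁ x₁ v' S₂ B₂) (cr : Critical G) :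
    False := by
  rcases cr.edge x₁ v h.v_adj_x₁.symm with ⟨w, hw, hwx, hwv⟩ | ⟨C, R, D, k, hx₁, hv⟩
  · have hwz : w ≠ z := by rintro rfl; exact h.fst.not_adj hwv
    have := cr.sparse w z x₁ hw hwz hwx h.snd.adj
    have := h.deg
    omega
  · rcases k.cover v' with h1 | h1 | h1
    · exact h.false_of_left cr k hx₁ hv h1
    · rcases k.cover x₂ with h2 | h2 | h2
      · exact h.false_of_mid_left cr k hx₁ hv h1 h2
      · exact h.false_of_mid cr k hx₁ hv h1 h2
      · exact h.false_of_mid_left cr k.symm hx₁ hv h1 h2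
    · exact h.false_of_left cr k.symm hx₁ hv h1

end LinkedPairs

/-- A critical graph has no vertex of degree four. -/
lemma Critical.five_le_card (cr : Critical G) (v : V) : 5 ≤ (G.neighborFinset v).card := by
  by_contra hlt
  obtain ⟨_, _, _, _, _, _, _, _, h⟩ := cr.exists_linkedPairs (z := v)
    (by have := cr.deg v; omega)
  exact h.false_of_critical cr

/-- A critical graph has no edges. -/
theorem Critical.not_adj (cr : Critical G) (x y : V) : ¬ G.Adj x y := by
  intro hxy
  have hdeg := cr.five_le_card
  have hedge : EdgesCovered G := by
    intro x y hxy
    rcases cr.edge x y hxy with ⟨w, hw, -⟩ | h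
    · have := hdeg w
      omega
    · exact h
  have hconn : FiveConn G := by
    intro A S B h hA hB
    have h4 := cr.four A S B h hA hB
    by_contra hlt
    have key : ∀ {A B : Finset V}, IsSep G A S B → A.card = 1 → False := by
      intro A B h h1
      obtain ⟨w, rfl⟩ := Finset.card_eq_one.1 h1
      have hsub : G.neighborFinset w ⊆ S := by
        intro u hu
        rw [SimpleGraph.mem_neighborFinset] at hu
        rcases h.neighbor_mem (by simp) hu with h2 | h2
        · rw [Finset.mem_singleton] at h2
          exact absurd h2.symm hu.ne
        · exact h2
      have := Finset.card_le_card hsub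
      have := hdeg w
      omega
    have hA' := Finset.card_pos.2 hA
    have hB' := Finset.card_pos.2 hB
    by_cases hA1 : A.card = 1
    · exact key h hA1
    · by_cases hB1 : B.card = 1
      · exact key h.symm hB1
      · have := cr.quasi A S B h (by omega) (by omega)
        omega
  obtain ⟨A, S, B, h, -⟩ := hedge x y hxy
  exact not_edgesCovered hconn hdeg ⟨A, S, B, h⟩ hedge

/-! ### Cuts, separations and contraction. -/

/-- A set of components of `G - T` determines a separation of `G` with middle `T`. -/
lemma isSep_components (G : SimpleGraph V) (T : Finset V)
    (C : Set (G.induce ((T : Set V)ᶜ)).ConnectedComponent) :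
    ∃ A B : Finset V, IsSep G A T B ∧
      (∀ v, v ∈ A ↔ ∃ h : v ∈ (T : Set V)ᶜ, (G.induce _).connectedComponentMk ⟨v, h⟩ ∈ C) ∧
      (∀ v, v ∈ B ↔ ∃ h : v ∈ (T : Set V)ᶜ, (G.induce _).connectedComponentMk ⟨v, h⟩ ∉ C) := by
  classical
  refine ⟨Finset.univ.filter fun v => ∃ h : v ∈ (T : Set V)ᶜ,
      (G.induce _).connectedComponentMk ⟨v, h⟩ ∈ C,
    Finset.univ.filter fun v => ∃ h : v ∈ (T : Set V)ᶜ,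
      (G.induce _).connectedComponentMk ⟨v, h⟩ ∉ C, ⟨?_, ?_, ?_, ?_, ?_⟩, by simp, by simp⟩
  · intro v
    by_cases hv : v ∈ T
    · exact Or.inr (Or.inl hv)
    · by_cases hc : (G.induce ((T : Set V)ᶜ)).connectedComponentMk ⟨v, by simpa using hv⟩ ∈ C
      · exact Or.inl (Finset.mem_filter.2 ⟨Finset.mem_univ _, _, hc⟩)
      · exact Or.inr (Or.inr (Finset.mem_filter.2 ⟨Finset.mem_univ _, _, hc⟩))
  · intro v hv
    obtain ⟨-, h, -⟩ := Finset.mem_filter.1 hv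
    simpa using h
  · intro v hv hv2
    obtain ⟨-, h, h1⟩ := Finset.mem_filter.1 hv
    obtain ⟨-, _, h2⟩ := Finset.mem_filter.1 hv2
    exact h2 h1
  · intro v hv hv2
    obtain ⟨-, h, -⟩ := Finset.mem_filter.1 hv2
    exact h (by simpa using hv)
  · intro a ha b hb hab
    obtain ⟨-, h, h1⟩ := Finset.mem_filter.1 ha
    obtain ⟨-, k, h2⟩ := Finset.mem_filter.1 hb
    have hadj : (G.induce ((T : Set V)ᶜ)).Adj ⟨a, h⟩ ⟨b, k⟩ := hab
    rw [SimpleGraph.ConnectedComponent.sound hadj.reachable] at h1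
    exact h2 h1

lemma IsSep.left_of_reachable {A S B : Finset V} (h : IsSep G A S B)
    {u v : ↥((S : Set V)ᶜ)} (huv : (G.induce ((S : Set V)ᶜ)).Reachable u v)
    (hu : (u : V) ∈ A) : (v : V) ∈ A := by
  obtain ⟨p⟩ := huv
  induction p with
  | nil => exact hu
  | @cons u w v hadj p ih =>
    refine ih ((h.neighbor_mem hu hadj).resolve_right ?_)
    exact w.2

lemma IsSep.not_preconnected {A S B : Finset V} (h : IsSep G A S B) (hA : A.Nonempty)
    (hB : B.Nonempty) : ¬ (G.induce ((S : Set V)ᶜ)).Preconnected := by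
  obtain ⟨a, ha⟩ := hA
  obtain ⟨b, hb⟩ := hB
  intro hp
  exact h.left_right b (h.left_of_reachable (hp ⟨a, by simpa using h.left_mid a ha⟩
    ⟨b, by simpa using fun hs => h.mid_right b hs hb⟩) ha) hb

lemma two_le_ncard_subtype {T : Set V} {p : ↥T → Prop} {A : Finset V}
    (hp : ∀ v ∈ A, ∃ h : v ∈ T, p ⟨v, h⟩) (hA : 2 ≤ A.card) : 2 ≤ {v : ↥T | p v}.ncard := by
  obtain ⟨a, ha, b, hb, hab⟩ := Finset.one_lt_card.1 hA
  obtain ⟨ha1, ha2⟩ := hp a ha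
  obtain ⟨hb1, hb2⟩ := hp b hb
  exact (Set.one_lt_ncard (Set.toFinite _)).2
    ⟨⟨a, ha1⟩, ha2, ⟨b, hb1⟩, hb2, fun h => hab (congrArg Subtype.val h)⟩

lemma two_le_card_of_ncard_subtype {T : Set V} {p : ↥T → Prop} {A : Finset V}
    (hp : ∀ v (h : v ∈ T), p ⟨v, h⟩ → v ∈ A) (hA : 2 ≤ {v : ↥T | p v}.ncard) : 2 ≤ A.card := by
  obtain ⟨a, ha, b, hb, hab⟩ := (Set.one_lt_ncard (Set.toFinite _)).1 hA
  exact Finset.one_lt_card.2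
    ⟨a, hp _ a.2 ha, b, hp _ b.2 hb, fun h => hab (Subtype.ext h)⟩

lemma IsSep.isNontrivialCut {A S B : Finset V} (h : IsSep G A S B) (hA : 2 ≤ A.card)
    (hB : 2 ≤ B.card) : IsNontrivialCut G S.card (S : Set V) := by
  refine ⟨Set.ncard_coe_finset S, h.not_preconnected (Finset.card_pos.1 (by omega))
    (Finset.card_pos.1 (by omega)), {c | ∃ v : ↥((S : Set V)ᶜ),
      (v : V) ∈ A ∧ (G.induce _).connectedComponentMk v = c}, ?_, ?_⟩
  · refine two_le_ncard_subtype (fun v hv => ?_) hA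
    exact ⟨by simpa using h.left_mid v hv, ⟨v, _⟩, hv, rfl⟩
  · refine two_le_ncard_subtype (fun v hv => ?_) hB
    refine ⟨by simpa using fun hs => h.mid_right v hs hv, ?_⟩
    rintro ⟨u, hu, huv⟩
    exact h.left_right v (h.left_of_reachable (SimpleGraph.ConnectedComponent.exact huv) hu) hv

lemma IsQuasiConnected.four_le (hG : IsQuasiConnected G 5) {A S B : Finset V}
    (h : IsSep G A S B) (hA : A.Nonempty) (hB : B.Nonempty) : 4 ≤ S.card := by
  by_contra hlt
  refine h.not_preconnected hA hB (hG.1.2 S ?_).preconnected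
  rw [Set.ncard_coe_finset]
  omega

lemma IsQuasiConnected.quasiFive (hG : IsQuasiConnected G 5) : QuasiFive G := by
  intro A S B h hA hB
  have h4 := hG.four_le h (Finset.card_pos.1 (by omega)) (Finset.card_pos.1 (by omega))
  by_contra hlt
  have hc := h.isNontrivialCut hA hB
  rw [show S.card = 5 - 1 by omega] at hc
  exact hG.2 _ hc

lemma isQuasiConnected_of_isSep (hV : 4 < Fintype.card V)
    (h4 : ∀ A S B : Finset V, IsSep G A S B → A.Nonempty → B.Nonempty → 4 ≤ S.card)
    (h5 : QuasiFive G) : IsQuasiConnected G 5 := by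
  classical
  refine ⟨⟨by rwa [Nat.card_eq_fintype_card], fun T hT => ?_⟩, fun T hT => ?_⟩
  · lift T to Finset V using T.toFinite
    rw [Set.ncard_coe_finset] at hT
    obtain ⟨v, hv⟩ : ∃ v, v ∉ T := by
      by_contra! hall
      rw [Finset.eq_univ_of_forall hall, Finset.card_univ] at hT
      omega
    refine (SimpleGraph.connected_iff _).2 ⟨fun u w => ?_, ⟨⟨v, by simpa using hv⟩⟩⟩
    by_contra hr
    obtain ⟨A, B, hs, hA, hB⟩ := isSep_components G T {(G.induce _).connectedComponentMk u}
    have := h4 A T B hs ⟨u, (hA _).2 ⟨u.2, rfl⟩⟩ ⟨w, (hB _).2 ⟨w.2, fun he => hr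
      (SimpleGraph.ConnectedComponent.exact he).symm⟩⟩
    omega
  · lift T to Finset V using T.toFinite
    obtain ⟨hcard, -, C, hC1, hC2⟩ := hT
    rw [Set.ncard_coe_finset] at hcard
    obtain ⟨A, B, hs, hA, hB⟩ := isSep_components G T C
    have := h5 A T B hs (two_le_card_of_ncard_subtype (fun v h hv => (hA v).2 ⟨h, hv⟩) hC1)
      (two_le_card_of_ncard_subtype (fun v h hv => (hB v).2 ⟨h, hv⟩) hC2)
    omega

section Map

variable {W : Type*} [Fintype W] [DecidableEq W] {f : V → W}

lemma IsSep.preimage {A S B : Finset W} (h : IsSep (G.map f) A S B) :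
    IsSep G (Finset.univ.filter (f · ∈ A)) (Finset.univ.filter (f · ∈ S))
      (Finset.univ.filter (f · ∈ B)) where
  cover v := by simpa using h.cover (f v)
  left_mid v := by simpa using h.left_mid (f v)
  left_right v := by simpa using h.left_right (f v)
  mid_right v := by simpa using h.mid_right (f v)
  not_adj a ha b hb hab := by
    simp only [Finset.mem_filter, Finset.mem_univ, true_and] at ha hb
    refine h.not_adj _ ha _ hb ?_
    exact ⟨fun he => h.left_right _ ha (he ▸ hb), a, b, hab, rfl, rfl⟩

lemma card_le_card_preimage (hf : Function.Surjective f) (A : Finset W) :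
    A.card ≤ (Finset.univ.filter (f · ∈ A)).card := by
  refine Finset.card_le_card_of_surjOn f fun w hw => ?_
  obtain ⟨v, rfl⟩ := hf w
  exact ⟨v, by simpa using hw, rfl⟩

/-- For the contraction map of an edge `xy`, this says that a preimage has at most one vertex more
than the set, and only if it contains `y`. -/
lemma card_preimage_erase_le {y : V} (hf : Set.InjOn f {y}ᶜ) (A : Finset W) :
    ((Finset.univ.filter (f · ∈ A)).erase y).card ≤ A.card := by
  refine Finset.card_le_card_of_injOn f (fun v hv => ?_) (hf.mono fun v hv => ?_)
  · simp only [Finset.coe_erase, Set.mem_sdiff, Finset.mem_coe, Finset.mem_filter] at hv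
    exact hv.1.2
  · simp only [Finset.coe_erase, Set.mem_sdiff] at hv
    exact hv.2

end Map

/-- The middle of a separation of order at most four is the neighbourhood of a vertex. -/
lemma IsQuasiConnected.exists_neighborFinset_eq (hG : IsQuasiConnected G 5)
    (hdeg : ∀ v, 4 ≤ (G.neighborFinset v).card) {A S B : Finset V} (h : IsSep G A S B)
    (hS : S.card ≤ 4) (hA : A.Nonempty) (hB : B.Nonempty) :
    ∃ w, G.neighborFinset w = S := by
  have key : ∀ {A B : Finset V}, IsSep G A S B → A.card = 1 → ∃ w, G.neighborFinset w = S := by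
    intro A B h h1
    obtain ⟨w, rfl⟩ := Finset.card_eq_one.1 h1
    refine ⟨w, Finset.eq_of_subset_of_card_le (fun u hu => ?_) (hS.trans (hdeg w))⟩
    rw [SimpleGraph.mem_neighborFinset] at hu
    rcases h.neighbor_mem (by simp) hu with h2 | h2
    · rw [Finset.mem_singleton] at h2
      exact absurd h2.symm hu.ne
    · exact h2
  have hA1 := Finset.card_pos.2 hA
  have hB1 := Finset.card_pos.2 hB
  by_cases hA2 : A.card = 1
  · exact key h hA2
  by_cases hB2 : B.card = 1
  · exact key h.symm hB2
  have := hG.quasiFive A S B h (by omega) (by omega)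
  omega

lemma mk_eq_mk_iff {x y u v : V} :
    Quotient.mk (contractSetoid s(x, y)) u = Quotient.mk (contractSetoid s(x, y)) v ↔
      u = v ∨ ((u = x ∨ u = y) ∧ (v = x ∨ v = y)) := by
  rw [Quotient.eq]
  change (u = v ∨ (u ∈ s(x, y) ∧ v ∈ s(x, y))) ↔ _
  simp

/-- A non-contractible edge lies in a triangle with a vertex of degree four, or in the middle of a
nontrivial separation of order five. -/
lemma IsQuasiConnected.edge_cases (hG : IsQuasiConnected G 5)
    (hdeg : ∀ v, 4 ≤ (G.neighborFinset v).card) (hV : 6 ≤ Fintype.card V) {x y : V}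
    (hn : ¬ IsQuasiConnected (contract G s(x, y)) 5) :
    (∃ w, (G.neighborFinset w).card = 4 ∧ G.Adj w x ∧ G.Adj w y) ∨
      ∃ A S B : Finset V, IsNSep G A S B ∧ x ∈ S ∧ y ∈ S := by
  classical
  set f : V → Quotient (contractSetoid s(x, y)) := Quotient.mk _ with hf
  have hsurj : Function.Surjective f := Quotient.mk_surjective
  have hxy : f x = f y := mk_eq_mk_iff.2 (by simp)
  have hinj : Set.InjOn f {y}ᶜ := by
    intro u hu v hv huv
    rcases mk_eq_mk_iff.1 huv with h | ⟨h1, h2⟩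
    · exact h
    · rw [h1.resolve_right hu, h2.resolve_right hv]
  have : Fintype (Quotient (contractSetoid s(x, y))) := Fintype.ofSurjective f hsurj
  have hcard : 4 < Fintype.card (Quotient (contractSetoid s(x, y))) := by
    have h1 := card_preimage_erase_le hinj Finset.univ
    rw [Finset.card_erase_of_mem (by simp)] at h1
    simp only [Finset.mem_univ, Finset.filter_true, Finset.card_univ] at h1
    omega
  by_contra! hcon
  obtain ⟨hw, hs⟩ := hcon
  -- Only middles containing the contracted vertex grow under preimage, by one vertex, and these
  -- preimages contain both `x` and `y`.
  have hS : ∀ S : Finset (Quotient (contractSetoid s(x, y))),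
      (Finset.univ.filter (f · ∈ S)).card ≤ S.card ∨
      ((Finset.univ.filter (f · ∈ S)).card ≤ S.card + 1 ∧
        x ∈ Finset.univ.filter (f · ∈ S) ∧ y ∈ Finset.univ.filter (f · ∈ S)) := by
    intro S
    have h1 := card_preimage_erase_le hinj S
    by_cases hy : y ∈ Finset.univ.filter (f · ∈ S)
    · rw [Finset.card_erase_of_mem hy] at h1
      refine Or.inr ⟨by omega, ?_, hy⟩
      simpa [hxy] using hy
    · rw [Finset.erase_eq_of_notMem hy] at h1
      exact Or.inl h1
  refine hn (isQuasiConnected_of_isSep hcard (fun A S B h hA hB => ?_) fun A S B h hA hB => ?_)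
  · have h' := h.preimage (G := G) (f := f)
    have hA' := Finset.card_pos.1 ((Finset.card_pos.2 hA).trans_le (card_le_card_preimage hsurj A))
    have hB' := Finset.card_pos.1 ((Finset.card_pos.2 hB).trans_le (card_le_card_preimage hsurj B))
    have h4 := hG.four_le h' hA' hB'
    rcases hS S with hle | ⟨hle, hx, hy⟩
    · omega
    · by_contra hlt
      obtain ⟨w, hwS⟩ := hG.exists_neighborFinset_eq hdeg h' (by omega) hA' hB'
      rw [← hwS, SimpleGraph.mem_neighborFinset] at hx hy
      exact hw w (by rw [hwS]; omega) hx hy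
  · have h' := h.preimage (G := G) (f := f)
    have hA' := hA.trans (card_le_card_preimage hsurj A)
    have hB' := hB.trans (card_le_card_preimage hsurj B)
    have h5 := hG.quasiFive _ _ _ h' hA' hB'
    rcases hS S with hle | ⟨hle, hx, hy⟩
    · omega
    · by_contra hlt
      exact hs _ _ _ ⟨h', by omega, hA', hB'⟩ hx hy

lemma isSep_neighborFinset (v : V) :
    IsSep G {v} (G.neighborFinset v) (insert v (G.neighborFinset v))ᶜ where
  cover u := by simp only [Finset.mem_singleton, Finset.mem_compl, Finset.mem_insert]; tauto
  left_mid u hu := by simp_all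
  left_right u hu := by simp_all
  mid_right u hu := by simp_all
  not_adj a ha b hb := by simp_all

lemma IsQuasiConnected.four_le_degree (hG : IsQuasiConnected G 5) (v : V) :
    4 ≤ (G.neighborFinset v).card := by
  by_cases hB : (insert v (G.neighborFinset v))ᶜ.Nonempty
  · exact hG.four_le (isSep_neighborFinset v) (by simp) hB
  · rw [Finset.not_nonempty_iff_eq_empty, Finset.compl_eq_empty_iff] at hB
    have h1 := Finset.card_insert_le v (G.neighborFinset v)
    have h2 := hG.1.1
    rw [hB, Finset.card_univ] at h1
    rw [Nat.card_eq_fintype_card] at h2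
    omega

end QuasiConn

/-! ### The theorem. -/

theorem theorem2 {V : Type*} [Fintype V] (G : SimpleGraph V) [DecidableRel G.Adj]
    (hG : QuasiConn.IsQuasiConnected G 5)
    (hdeg : ∀ x y : V, G.dist x y = 1 ∨ G.dist x y = 2 → 9 ≤ G.degree x + G.degree y) :
    ∃ e : Sym2 V, QuasiConn.IsQuasiContractible G 5 e := by
  classical
  have h4 := hG.four_le_degree
  have hadj : ∀ a b, G.Adj a b → 9 ≤ G.degree a + G.degree b := fun a b h =>
    hdeg a b (Or.inl (SimpleGraph.dist_eq_one_iff_adj.2 h))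
  have hcommon : ∀ a b c, a ≠ b → G.Adj a c → G.Adj b c → 9 ≤ G.degree a + G.degree b := by
    intro a b c hab hac hbc
    by_cases h : G.Adj a b
    · exact hadj a b h
    refine hdeg a b (Or.inr ?_)
    let p : G.Walk a b := .cons hac (.cons hbc.symm .nil)
    have h1 : G.dist a b ≤ 2 := SimpleGraph.dist_le p
    have h2 : 0 < G.dist a b := p.reachable.pos_dist_of_ne hab
    have h3 : G.dist a b ≠ 1 := fun h1 => h (SimpleGraph.dist_eq_one_iff_adj.1 h1)
    omega
  simp only [← SimpleGraph.card_neighborFinset_eq_degree] at hadj hcommon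
  obtain ⟨x⟩ : Nonempty V := by
    have := hG.1.1
    exact (Nat.card_pos_iff.1 (by omega)).1
  obtain ⟨y, hy⟩ := Finset.card_pos.1 ((by norm_num : 0 < 4).trans_le (h4 x))
  rw [SimpleGraph.mem_neighborFinset] at hy
  -- One end of the edge has degree at least five. The sixth vertex keeps the contracted graph above
  -- four vertices.
  have hV : 6 ≤ Fintype.card V := by
    have h1 := hadj x y hy
    have h2 := G.degree_lt_card_verts x
    have h3 := G.degree_lt_card_verts y
    rw [← SimpleGraph.card_neighborFinset_eq_degree] at h2 h3
    omega
  by_contra! hcon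
  have cr : QuasiConn.Critical G :=
    { four := fun A S B h => hG.four_le h
      quasi := hG.quasiFive
      deg := h4
      sparse_adj := fun a b ha hab => by have := hadj a b hab; omega
      sparse := fun a b c ha hab hac hbc => by have := hcommon a b c hab hac hbc; omega
      edge := fun x y hxy => hG.edge_cases h4 hV fun h =>
        hcon s(x, y) ⟨G.mem_edgeSet.2 hxy, h⟩ }
  exact cr.not_adj x y hy
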